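/- **Conventions.** All Hilbert spaces are complex; $\ell_2^n=\mathbb C^n$ with its Euclidean inner product, and $\ell_2$ is the space of square-summable complex sequences with its standard orthonormal basis $\{e_i\}$. For a finite family $\{f_i\}_{i\in I}$ in a Hilbert space $\mathbb H$, a number $A>0$ is a *lower frame bound* if $A\|f\|^2\le\sum_{i\in I}|\langle f,f_i\rangle|^2$ for all $f\in\mathbb H$, and $B$ is a *Bessel bound* if $\sum_{i\in I}|\langle f,f_i\rangle|^2\le B\|f\|^2$ for all $f\in\mathbb H$. The family is a *Parseval frame* for $\mathbb H$ if $1$ is both a lower frame bound and a Bessel bound, and it is *equal norm* if all $f_i$ have the same norm. The pieces of a partition may be empty. **Conjecture A.** There exist $\epsilon>0$ and $K_0\in\mathbb N$ such that for all $K\ge K_0$, all $n$ and all equal norm Parseval frames $\{f_i\}_{i=1}^{Kn}$ for $\ell_2^n$, there is a $J\subset\{1,\dots,Kn\}$ so that both $\{f_i\}_{i\in J}$ and $\{f_i\}_{i\in J^c}$ have a lower frame bound greater than $\epsilon$. **Conjecture B.** There exist $\epsilon>0$ and natural numbers $r$ and $K_0$ such that for all $K\ge K_0$, all $n$ and all equal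 norm Parseval frames $\{f_i\}_{i=1}^{Kn}$ for $\ell_2^n$, there is a partition $\{A_j\}_{j=1}^r$ of $\{1,\dots,Kn\}$ so that for every $j=1,\dots,r$ the family $\{f_i\}_{i\in A_j}$ has Bessel bound $\le 1-\epsilon$. **Kadison–Singer (KS).** Let $\mathbb D\subset B(\ell_2)$ be the algebra of bounded operators whose matrix with respect to $\{e_i\}$ is diagonal. A *state* on $\mathbb D$ or on $B(\ell_2)$ is a linear functional $\varphi$ with $\varphi(I)=1$ and $\varphi(T)\ge 0$ for every positive operator $T$ of the algebra; a *pure state* is an extreme point of the convex set of states. KS is the assertion that every pure state on $\mathbb D$ has an extension to a pure state on $B(\ell_2)$, and that this is its only extension to a state on $B(\ell_2)$. **Theorem.** (1) Conjecture A implies Conjecture B. (2) Conjecture B is equivalent to KS. -/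

import Mathlib

open scoped ComplexOrder InnerProductSpace

namespace KadisonSinger

/-! Finite frames -/

section Frames

variable {ι H : Type*} [NormedAddCommGroup H] [InnerProductSpace ℂ H]

/-- The finite subfamily `(f i)`, `i ∈ J`, is bounded below by `A`:
`A ‖x‖² ≤ ∑ i ∈ J, |⟨x, f i⟩|²` for all `x`, where `A` is positive. -/
def IsLowerFrameBound (f : ι → H) (J : Finset ι) (A : ℝ) : Prop :=
  0 < A ∧ ∀ x : H, A * ‖x‖ ^ 2 ≤ ∑ i ∈ J, ‖⟪f i, x⟫_ℂ‖ ^ 2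

/-- The finite subfamily `(f i)`, `i ∈ J`, has Bessel bound `B`:
`∑ i ∈ J, |⟨x, f i⟩|² ≤ B ‖x‖²` for all `x`. -/
def IsBesselBound (f : ι → H) (J : Finset ι) (B : ℝ) : Prop :=
  ∀ x : H, ∑ i ∈ J, ‖⟪f i, x⟫_ℂ‖ ^ 2 ≤ B * ‖x‖ ^ 2

/-- A (finite) Parseval frame: a frame with both bounds equal to one. -/
def IsParsevalFrame [Fintype ι] (f : ι → H) : Prop :=
  IsLowerFrameBound f Finset.univ 1 ∧ IsBesselBound f Finset.univ 1

/-- All members of the family have the same norm. -/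
def IsEqualNorm (f : ι → H) : Prop :=
  ∀ i j, ‖f i‖ = ‖f j‖

/-- A partition of a finite index set into `r` pieces (some of which may be empty). -/
structure IsPartition [Fintype ι] {r : ℕ} (A : Fin r → Finset ι) : Prop where
  disjoint : ∀ j k, j ≠ k → Disjoint (A j) (A k)
  cover : ∀ i, ∃ j, i ∈ A j

end Frames

/-- There is `ε > 0` such that, for all sufficiently large `K`, every equal norm Parseval frame of
`K n` vectors of `ℂⁿ` splits into two subfamilies with lower frame bounds greater than `ε`. -/
def ErasureConjecture : Prop :=
  ∃ ε : ℝ, 0 < ε ∧ ∃ K₀ : ℕ, ∀ K : ℕ, K₀ ≤ K → ∀ n : ℕ,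
    ∀ f : Fin (K * n) → EuclideanSpace ℂ (Fin n), IsEqualNorm f → IsParsevalFrame f →
      ∃ J : Finset (Fin (K * n)),
        (∃ A : ℝ, ε < A ∧ IsLowerFrameBound f J A) ∧
        (∃ A : ℝ, ε < A ∧ IsLowerFrameBound f Jᶜ A)

/-- There are `ε > 0` and `r` such that, for all sufficiently large `K`, every equal norm Parseval
frame of `K n` vectors of `ℂⁿ` can be partitioned into `r` subfamilies with Bessel bound at most
`1 - ε`. -/
def BesselPartitionConjecture : Prop :=
  ∃ ε : ℝ, 0 < ε ∧ ∃ r : ℕ, ∃ K₀ : ℕ, ∀ K : ℕ, K₀ ≤ K → ∀ n : ℕ,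
    ∀ f : Fin (K * n) → EuclideanSpace ℂ (Fin n), IsEqualNorm f → IsParsevalFrame f →
      ∃ A : Fin r → Finset (Fin (K * n)), IsPartition A ∧
        ∀ j, IsBesselBound f (A j) (1 - ε)

/-! The Kadison-Singer problem -/

/-- The Hilbert space `ℓ₂` of square-summable complex sequences. -/
abbrev Ell2 : Type := lp (fun _ : ℕ => ℂ) 2

/-- The orthonormal basis vector `e i` of `ℓ₂`. -/
noncomputable def e (i : ℕ) : Ell2 := lp.single 2 i 1

/-- The off-diagonal matrix entries `⟨T e_j, e_i⟩` of `T` vanish. -/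
def IsDiagonal (T : Ell2 →L[ℂ] Ell2) : Prop :=
  ∀ i j : ℕ, i ≠ j → ⟪e i, T (e j)⟫_ℂ = 0

theorem inner_e (i : ℕ) (x : Ell2) : ⟪e i, x⟫_ℂ = x i := by
  simp [e, lp.inner_single_left]

theorem IsDiagonal.apply_e {T : Ell2 →L[ℂ] Ell2} (hT : IsDiagonal T) (j : ℕ) :
    T (e j) = (T (e j) j) • e j := by
  ext i
  by_cases h : i = j
  · subst h
    simp [e]
  · have h1 := hT i j h
    rw [inner_e] at h1
    rw [h1]
    simp [e, h]

/-- The star-algebra `𝔻` of bounded diagonal operators on `ℓ₂`. -/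
noncomputable def diagonalAlgebra : StarSubalgebra ℂ (Ell2 →L[ℂ] Ell2) where
  carrier := {T | IsDiagonal T}
  mul_mem' := by
    intro S T hS hT i j hij
    rw [mul_apply_eq_comp, hT.apply_e j, map_smul, inner_smul_right, hS i j hij,
      mul_zero]
  add_mem' := by
    intro S T hS hT i j hij
    rw [add_apply, inner_add_right, hS i j hij, hT i j hij, add_zero]
  algebraMap_mem' := by
    intro c i j hij
    rw [inner_e]
    simp [e, Algebra.algebraMap_eq_smul_one, hij]
  star_mem' := by
    intro T hT i j hij
    rw [ContinuousLinearMap.star_eq_adjoint, ContinuousLinearMap.adjoint_inner_right,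
      ← inner_conj_symm, hT j i hij.symm, map_zero]

/-- A state: a linear functional `φ` with `φ 1 = 1` and `φ T ≥ 0` whenever `T ≥ 0`. For operators
on a Hilbert space, `0 ≤ T` is the order in which the nonnegative elements are the positive
operators; a subalgebra carries the induced order. -/
def IsState {R : Type*} [Ring R] [Algebra ℂ R] [PartialOrder R] (φ : R →ₗ[ℂ] ℂ) : Prop :=
  φ 1 = 1 ∧ ∀ T : R, 0 ≤ T → 0 ≤ φ T

/-- A pure state: an extreme point of the convex set of states. -/
def IsPureState {R : Type*} [Ring R] [Algebra ℂ R] [PartialOrder R] (φ : R →ₗ[ℂ] ℂ) : Prop :=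
  φ ∈ Set.extremePoints ℝ {ψ : R →ₗ[ℂ] ℂ | IsState ψ}

/-- The linear functional `ψ` on `B(ℓ₂)` extends the linear functional `φ` on `𝔻`. -/
def Extends (ψ : (Ell2 →L[ℂ] Ell2) →ₗ[ℂ] ℂ) (φ : diagonalAlgebra →ₗ[ℂ] ℂ) : Prop :=
  ∀ T : diagonalAlgebra, ψ (T : Ell2 →L[ℂ] Ell2) = φ T

/-- A positive answer to the Kadison-Singer problem: every pure state on `𝔻` has an extension to a
pure state on `B(ℓ₂)`, and this is its only extension to a state on `B(ℓ₂)`. -/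
def KadisonSingerProperty : Prop :=
  ∀ φ : diagonalAlgebra →ₗ[ℂ] ℂ, IsPureState φ →
    ∃ ψ : (Ell2 →L[ℂ] Ell2) →ₗ[ℂ] ℂ, IsPureState ψ ∧ Extends ψ φ ∧
      ∀ ψ' : (Ell2 →L[ℂ] Ell2) →ₗ[ℂ] ℂ, IsState ψ' → Extends ψ' φ → ψ' = ψ

end KadisonSinger

namespace KadisonSinger

/-! States on star-algebras -/

section States

variable {R : Type*} [Ring R] [StarRing R] [Algebra ℂ R] [StarModule ℂ R] [PartialOrder R]

/-! A implies B with two pieces: a lower bound for one piece, subtracted from the Parseval identity,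
is a Bessel bound below one for the other.

B implies KS by way of paving. A projection matrix with constant diagonal 1/K is the Gram matrix of
an equal norm Parseval frame, so B paves all such projections for large K. A tensor product argument
(`ProjectionPaving.of_sq`) descends from K² to K, hence from 2^(2^m) to 2. Projections with diagonal
1/2 are dilations of Hermitian contractions with zero diagonal, so these are paved as well;
compactness carries this to ℓ₂. A pure state on 𝔻 has value one on exactly one colour class, and
every extension is concentrated there. Iterating the paving shows that the extension kills all
operators with zero diagonal, so it is the given state composed with `diagPart`.

KS implies B by contradiction. Counterexamples for every r are joined in a direct sum into one
infinite Bessel family of small vectors having no finite colouring with bound 1/2. Along an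
ultrafilter avoiding all good index sets, basis vectors and suitable spread-out unit vectors define
two states that extend the same pure state but differ on the Gram operator. -/

theorem IsState.map_star {φ : R →ₗ[ℂ] ℂ} (hφ : IsState φ) (hR : ∀ b : R, 0 ≤ star b * b) (d : R) :
    φ (star d) = star (φ d) := by
  have h0 := Complex.nonneg_iff.1 (hφ.2 _ (hR d))
  have h1 := Complex.nonneg_iff.1 (hφ.2 _ (hR (1 + d)))
  have h2 := Complex.nonneg_iff.1 (hφ.2 _ (hR (1 + Complex.I • d)))
  have e1 : star (1 + d) * (1 + d) = 1 + d + star d + star d * d := by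
    rw [star_add, star_one]; noncomm_ring
  have e2 : star (1 + Complex.I • d) * (1 + Complex.I • d)
      = 1 + Complex.I • d + (-Complex.I) • star d + star d * d := by
    rw [star_add, star_one, star_smul, add_mul, mul_add, mul_add, smul_mul_smul_comm]
    simp
    abel
  rw [e1] at h1
  rw [e2] at h2
  simp only [map_add, map_smul, hφ.1, smul_eq_mul, Complex.add_im, Complex.mul_im, Complex.I_re,
    Complex.I_im, Complex.neg_re, Complex.neg_im, Complex.one_im] at h1 h2
  apply Complex.ext
  · simp; linarith [h0.2, h2.2]
  · simp; linarith [h0.2, h1.2]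

/-- The variance φ((d - φ(d))* (d - φ(d))) is nonnegative. -/
theorem IsState.norm_sq_le {φ : R →ₗ[ℂ] ℂ} (hφ : IsState φ) (hR : ∀ b : R, 0 ≤ star b * b) (d : R) :
    ‖φ d‖ ^ 2 ≤ (φ (star d * d)).re := by
  have h := (Complex.nonneg_iff.1 (hφ.2 _ (hR (d - (φ d) • 1)))).1
  have e1 : star (d - (φ d) • (1 : R)) * (d - (φ d) • 1)
      = star d * d - (φ d) • star d - star (φ d) • d + (star (φ d) * φ d) • 1 := by
    rw [star_sub, star_smul, star_one, sub_mul, mul_sub, mul_sub, smul_mul_smul_comm]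
    simp
    abel
  rw [e1] at h
  simp only [map_add, map_sub, map_smul, hφ.1, hφ.map_star hR, smul_eq_mul] at h
  rw [← Complex.normSq_eq_norm_sq, Complex.normSq_apply]
  simp at h
  linarith

theorem IsState.eq_zero_of_star_mul_self {φ : R →ₗ[ℂ] ℂ} (hφ : IsState φ)
    (hR : ∀ b : R, 0 ≤ star b * b) {d : R} (hd : (φ (star d * d)).re ≤ 0) : φ d = 0 := by
  have := hφ.norm_sq_le hR d
  have h2 : ‖φ d‖ ^ 2 = 0 := le_antisymm (this.trans hd) (by positivity)
  simpa using h2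

/-- A state that vanishes at `d* d` whenever it vanishes at `d` is pure. -/
theorem IsState.isPureState {φ : R →ₗ[ℂ] ℂ} (hφ : IsState φ) (hR : ∀ b : R, 0 ≤ star b * b)
    (h : ∀ d, φ d = 0 → φ (star d * d) = 0) : IsPureState φ := by
  refine mem_extremePoints_iff_left.2 ⟨hφ, fun ψ₁ h₁ ψ₂ h₂ ⟨a, b, ha, hb, hab, hs⟩ => ?_⟩
  -- Both components are nonnegative at d* d and their weighted sum vanishes there, so ψ₁ kills the
  -- kernel of φ; normalisation then gives ψ₁ = φ.
  have key : ∀ d, φ d = 0 → ψ₁ d = 0 := by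
    intro d hd
    refine IsState.eq_zero_of_star_mul_self h₁ hR ?_
    have h3 := congrArg Complex.re (h d hd)
    rw [← hs] at h3
    have h4 := (Complex.nonneg_iff.1 (h₂.2 _ (hR d))).1
    simp at h3
    have : a * (ψ₁ (star d * d)).re ≤ 0 := by nlinarith
    exact nonpos_of_mul_nonpos_right this ha
  ext d
  have := key (d - (φ d) • 1) (by simp [hφ.1])
  simpa [h₁.1, sub_eq_zero] using this

/-- A pure state takes the values `0` and `1` on projections whose multiplication operators are
positive. -/
theorem IsPureState.eq_zero_or_eq_one {R : Type*} [Ring R] [Algebra ℂ R] [PartialOrder R]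
    {φ : R →ₗ[ℂ] ℂ} (hφ : IsPureState φ) {q : R} (hq : q * q = q)
    (h0 : (0 : R) ≤ 1) (h1 : ∀ T, 0 ≤ T → 0 ≤ q * T) (h2 : ∀ T, 0 ≤ T → 0 ≤ (1 - q) * T) :
    φ q = 0 ∨ φ q = 1 := by
  have hs : IsState φ := hφ.1
  have a1 := Complex.nonneg_iff.1 (hs.2 _ (h1 1 h0))
  have a2 := Complex.nonneg_iff.1 (hs.2 _ (h2 1 h0))
  rw [mul_one] at a1 a2
  rw [map_sub, hs.1] at a2
  obtain ⟨t, ht⟩ : ∃ t : ℝ, φ q = t := ⟨(φ q).re, by apply Complex.ext <;> simp [← a1.2]⟩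
  rw [ht] at a1 a2 ⊢
  simp at a1 a2
  rcases eq_or_lt_of_le a1 with h | hpos
  · left; simp [← h]
  rcases eq_or_lt_of_le a2 with h | hlt
  · right; simp [h]
  exfalso
  have htc : (t : ℂ) ≠ 0 := by exact_mod_cast hpos.ne'
  have htc' : (1 - t : ℂ) ≠ 0 := by exact_mod_cast (sub_pos.2 hlt).ne'
  -- For 0 < t < 1, cutting by q and by 1 - q writes φ as a proper convex combination. Extremality
  -- forces ψ₁ = φ, although ψ₁(q) = 1 and φ(q) = t.
  let ψ₁ : R →ₗ[ℂ] ℂ := (t : ℂ)⁻¹ • φ.comp (LinearMap.mulLeft ℂ q)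
  let ψ₂ : R →ₗ[ℂ] ℂ := (1 - t : ℂ)⁻¹ • φ.comp (LinearMap.mulLeft ℂ (1 - q))
  have s1 : IsState ψ₁ := by
    refine ⟨by simp [ψ₁, ht, htc], fun T hT => ?_⟩
    have := hs.2 _ (h1 T hT)
    simp only [ψ₁, LinearMap.smul_apply, LinearMap.comp_apply, LinearMap.mulLeft_apply, smul_eq_mul]
    refine mul_nonneg ?_ this
    exact_mod_cast (inv_pos.2 hpos).le
  have s2 : IsState ψ₂ := by
    refine ⟨by simp [ψ₂, ht, hs.1, htc'], fun T hT => ?_⟩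
    have := hs.2 _ (h2 T hT)
    simp only [ψ₂, LinearMap.smul_apply, LinearMap.comp_apply, LinearMap.mulLeft_apply, smul_eq_mul]
    refine mul_nonneg ?_ this
    exact_mod_cast (inv_pos.2 (sub_pos.2 hlt)).le
  have := (mem_extremePoints_iff_left.1 hφ).2 ψ₁ s1 ψ₂ s2 ⟨t, 1 - t, hpos, sub_pos.2 hlt, by ring, by
    ext d
    have e1 : (t : ℂ) * ((t : ℂ)⁻¹ * φ (q * d)) = φ (q * d) := by field_simp
    have e2 : (1 - t : ℂ) * ((1 - t : ℂ)⁻¹ * φ ((1 - q) * d)) = φ ((1 - q) * d) := by field_simp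
    simp only [ψ₁, ψ₂, LinearMap.add_apply, LinearMap.smul_apply, LinearMap.comp_apply,
      LinearMap.mulLeft_apply, smul_eq_mul, Complex.real_smul, Complex.ofReal_sub,
      Complex.ofReal_one, e1, e2]
    rw [← map_add, ← add_mul]
    simp⟩
  have h5 := LinearMap.congr_fun this q
  simp [ψ₁, hq, ht, htc] at h5
  exact hlt.ne (by exact_mod_cast h5.symm)

end States

/-! Diagonal operators on `ℓ₂` -/

section Diagonal

theorem star_mul_self_nonneg_operator (b : Ell2 →L[ℂ] Ell2) : 0 ≤ star b * b :=
  star_mul_self_nonneg b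

theorem star_mul_self_nonneg_diagonal (b : diagonalAlgebra) : 0 ≤ star b * b :=
  star_mul_self_nonneg (b : Ell2 →L[ℂ] Ell2)

/-- The operator of coordinatewise multiplication by a bounded sequence. -/
noncomputable def diagOp (d : ℕ → ℂ) {C : ℝ} (hC : 0 ≤ C) (h : ∀ i, ‖d i‖ ≤ C) :
    Ell2 →L[ℂ] Ell2 :=
  lp.mapCLM 2 (fun i => d i • ContinuousLinearMap.id ℂ ℂ) hC (fun i => by
    rw [norm_smul]; simpa using h i)

theorem diagOp_apply (d : ℕ → ℂ) {C : ℝ} (hC : 0 ≤ C) (h : ∀ i, ‖d i‖ ≤ C) (x : Ell2) (i : ℕ) :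
    diagOp d hC h x i = d i * x i := by
  simp [diagOp, lp.mapCLM]

theorem e_apply (i j : ℕ) : e j i = if i = j then 1 else 0 := by
  simp [e, Pi.single_apply]

theorem norm_e (i : ℕ) : ‖e i‖ = 1 := by
  simp [e]

theorem isDiagonal_diagOp (d : ℕ → ℂ) {C : ℝ} (hC : 0 ≤ C) (h : ∀ i, ‖d i‖ ≤ C) :
    IsDiagonal (diagOp d hC h) := by
  intro i j hij
  rw [inner_e, diagOp_apply, e_apply, if_neg hij, mul_zero]

theorem norm_entry_le (T : Ell2 →L[ℂ] Ell2) (i j : ℕ) : ‖T (e j) i‖ ≤ ‖T‖ := by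
  rw [← inner_e]
  refine (norm_inner_le_norm _ _).trans ?_
  rw [norm_e, one_mul]
  simpa [norm_e] using T.le_opNorm (e j)

theorem IsDiagonal.apply {T : Ell2 →L[ℂ] Ell2} (hT : IsDiagonal T) (x : Ell2) (i : ℕ) :
    T x i = T (e i) i * x i := by
  have h : IsDiagonal (star T) := diagonalAlgebra.star_mem' hT
  rw [← inner_e, ← ContinuousLinearMap.adjoint_inner_left, ← ContinuousLinearMap.star_eq_adjoint,
    h.apply_e, inner_smul_left, inner_e, ← inner_e i, ContinuousLinearMap.star_eq_adjoint,
    ContinuousLinearMap.adjoint_inner_right, inner_conj_symm, inner_e]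

/-- The conditional expectation onto the diagonal. -/
noncomputable def diagPart : (Ell2 →L[ℂ] Ell2) →ₗ[ℂ] diagonalAlgebra where
  toFun T := ⟨diagOp (fun i => T (e i) i) (norm_nonneg T) fun i => norm_entry_le T i i,
    isDiagonal_diagOp _ _ _⟩
  map_add' S T := by
    apply Subtype.ext
    ext x i
    simp [diagOp_apply, add_mul]
  map_smul' c T := by
    apply Subtype.ext
    ext x i
    simp [diagOp_apply, mul_assoc]

theorem diagPart_apply (T : Ell2 →L[ℂ] Ell2) (x : Ell2) (i : ℕ) :
    (diagPart T : Ell2 →L[ℂ] Ell2) x i = T (e i) i * x i :=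
  diagOp_apply _ (norm_nonneg T) (fun i => norm_entry_le T i i) _ _

theorem diagPart_coe (T : diagonalAlgebra) : diagPart (T : Ell2 →L[ℂ] Ell2) = T := by
  apply Subtype.ext
  ext x i
  rw [diagPart_apply]
  exact (IsDiagonal.apply T.2 x i).symm

/-- The quadratic form of the diagonal part is the sum of T_ii |x_i|², with each T_ii nonnegative.
-/
theorem diagPart_nonneg {T : Ell2 →L[ℂ] Ell2} (hT : 0 ≤ T) : 0 ≤ diagPart T := by
  change (0 : Ell2 →L[ℂ] Ell2) ≤ (diagPart T : Ell2 →L[ℂ] Ell2)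
  rw [ContinuousLinearMap.nonneg_iff_isPositive] at hT ⊢
  rw [ContinuousLinearMap.isPositive_iff_complex]
  intro x
  have h : 0 ≤ ⟪(diagPart T : Ell2 →L[ℂ] Ell2) x, x⟫_ℂ := by
    refine (lp.hasSum_inner ((diagPart T : Ell2 →L[ℂ] Ell2) x) x).nonneg fun i => ?_
    rw [diagPart_apply]
    have h1 := hT.inner_nonneg_left (e i)
    rw [← inner_conj_symm, inner_e] at h1
    have h2 : 0 ≤ (x i) * star (x i) := mul_star_self_nonneg _
    have := mul_nonneg h1 h2
    simp at this ⊢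
    convert this using 1
    ring
  rw [Complex.nonneg_iff] at h
  exact ⟨Complex.ext (by simp) (by simpa using h.2), h.1⟩

theorem diagPart_one : diagPart 1 = 1 := diagPart_coe 1

/-- Composing a state on the diagonal with the expectation extends it to a state. -/
theorem IsState.comp_diagPart {φ : diagonalAlgebra →ₗ[ℂ] ℂ} (hφ : IsState φ) :
    IsState (φ.comp diagPart) :=
  ⟨by simp [diagPart_one, hφ.1], fun _ hT => hφ.2 _ (diagPart_nonneg hT)⟩

theorem extends_comp_diagPart (φ : diagonalAlgebra →ₗ[ℂ] ℂ) : Extends (φ.comp diagPart) φ :=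
  fun T => by simp [diagPart_coe]

end Diagonal

/-! Paving of finite projection matrices with constant diagonal -/

section FinitePaving

/-- The squared Euclidean norm of a vector. -/
noncomputable def normSum {X : Type*} [Fintype X] (v : X → ℂ) : ℝ := ∑ x, ‖v x‖ ^ 2

/-- The projection matrices with all diagonal entries `1 / K` can be paved: for some `r` and
`ε > 0`, there is a colouring of the index set by `r` colours such that `P` shrinks the squared norm
of each vector supported on one colour by the factor `1 - ε`. -/
def ProjectionPaving (K : ℕ) : Prop :=
  ∃ r : ℕ, ∃ ε : ℝ, 0 < ε ∧ ∀ (X : Type) [Fintype X] [DecidableEq X] (P : Matrix X X ℂ),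
    P.IsHermitian → P * P = P → (∀ x, P x x = (K : ℂ)⁻¹) →
      ∃ c : X → Fin r, ∀ j, ∀ v : X → ℂ, (∀ x, c x ≠ j → v x = 0) →
        normSum (P.mulVec v) ≤ (1 - ε) * normSum v

open scoped Kronecker in
theorem kronecker_mulVec_mul {X Y : Type*} [Fintype X] [Fintype Y] (P : Matrix X X ℂ)
    (Q : Matrix Y Y ℂ) (v : X → ℂ) (w : Y → ℂ) :
    (P ⊗ₖ Q).mulVec (fun z => v z.1 * w z.2) = fun z => P.mulVec v z.1 * Q.mulVec w z.2 := by
  ext ⟨x, y⟩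
  simp only [Matrix.mulVec, dotProduct, Matrix.kronecker_apply, Fintype.sum_prod_type,
    Finset.sum_mul_sum]
  exact Finset.sum_congr rfl fun a _ => Finset.sum_congr rfl fun b _ => by ring

theorem normSum_mul {X Y : Type*} [Fintype X] [Fintype Y] (v : X → ℂ) (w : Y → ℂ) :
    normSum (fun z : X × Y => v z.1 * w z.2) = normSum v * normSum w := by
  simp only [normSum, Fintype.sum_prod_type, Finset.sum_mul_sum, norm_mul, mul_pow]

theorem normSum_nonneg {X : Type*} [Fintype X] (v : X → ℂ) : 0 ≤ normSum v :=
  Finset.sum_nonneg fun _ _ => by positivity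

open scoped Kronecker in
-- If paving failed for K, two unpavable projections P and Q could be tensored. A colouring of X × Y
-- colours each y by its whole pattern on X; a bad w for Q lives on one pattern, and that pattern,
-- as a colouring of X, has a bad v for P. Then v ⊗ w lives on one colour and contradicts paving of
-- P ⊗ Q.
theorem ProjectionPaving.of_sq {K : ℕ} (h : ProjectionPaving (K * K)) : ProjectionPaving K := by
  obtain ⟨r, ε, hε, H⟩ := h
  by_contra hK
  have hneg : ∀ s : ℕ, ∃ (X : Type) (_ : Fintype X) (_ : DecidableEq X) (P : Matrix X X ℂ),
      P.IsHermitian ∧ P * P = P ∧ (∀ x, P x x = (K : ℂ)⁻¹) ∧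
      ∀ c : X → Fin s, ∃ j, ∃ v : X → ℂ, (∀ x, c x ≠ j → v x = 0) ∧
        (1 - min (ε / 2) (1 / 2)) * normSum v < normSum (P.mulVec v) := by
    intro s
    by_contra hs
    push Not at hs
    exact hK ⟨s, min (ε / 2) (1 / 2), by positivity, fun X i₁ i₂ P h1 h2 h3 =>
      hs X i₁ i₂ P h1 h2 h3⟩
  -- Chosen so that (1 - η)² ≥ 1 - 2η ≥ 1 - ε, with 1 - η positive.
  set η := min (ε / 2) (1 / 2) with hη
  have hη1 : η ≤ ε / 2 := min_le_left _ _
  have hη2 : η ≤ 1 / 2 := min_le_right _ _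
  obtain ⟨X, _, _, P, hP1, hP2, hP3, hP⟩ := hneg r
  obtain ⟨Y, _, _, Q, hQ1, hQ2, hQ3, hQ⟩ := hneg (Fintype.card (X → Fin r))
  obtain ⟨c, hc⟩ := H (X × Y) (P ⊗ₖ Q)
    (by rw [Matrix.IsHermitian, Matrix.conjTranspose_kronecker, hP1.eq, hQ1.eq])
    (by rw [← Matrix.mul_kronecker_mul, hP2, hQ2])
    (by rintro ⟨x, y⟩; rw [Matrix.kronecker_apply, hP3, hQ3]; push_cast; rw [mul_inv])
  obtain ⟨J, w, hw, hwlt⟩ := hQ fun y => Fintype.equivFin (X → Fin r) fun x => c (x, y)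
  obtain ⟨j, v, hv, hvlt⟩ := hP ((Fintype.equivFin (X → Fin r)).symm J)
  have := hc j (fun z => v z.1 * w z.2) (by
    rintro ⟨x, y⟩ hxy
    by_cases h1 : (Fintype.equivFin (X → Fin r) fun x => c (x, y)) = J
    · rw [hv x, zero_mul]
      rw [← h1, Equiv.symm_apply_apply]
      exact hxy
    · rw [hw y h1, mul_zero])
  rw [kronecker_mulVec_mul, normSum_mul, normSum_mul] at this
  have hv0 := normSum_nonneg v
  have hw0 := normSum_nonneg w
  have h1 : ((1 - η) * normSum v) * ((1 - η) * normSum w)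
      < normSum (P.mulVec v) * normSum (Q.mulVec w) :=
    mul_lt_mul'' hvlt hwlt (by nlinarith) (by nlinarith)
  have h2 : (1 - ε) * (normSum v * normSum w) ≤ (1 - η) * (1 - η) * (normSum v * normSum w) :=
    mul_le_mul_of_nonneg_right (by nlinarith) (by positivity)
  linarith

theorem ProjectionPaving.two_of_pow (m : ℕ) (h : ProjectionPaving (2 ^ 2 ^ m)) :
    ProjectionPaving 2 := by
  induction m with
  | zero => simpa using h
  | succ m ih =>
    refine ih (ProjectionPaving.of_sq ?_)
    rwa [← pow_add, ← two_mul, ← pow_succ']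

end FinitePaving

/-! Gram projections of Parseval frames -/

section Gram

theorem IsParsevalFrame.sum_norm_sq {ι : Type*} [Fintype ι] {n : ℕ}
    {f : ι → EuclideanSpace ℂ (Fin n)} (hf : IsParsevalFrame f) : ∑ i, ‖f i‖ ^ 2 = n := by
  let b := EuclideanSpace.basisFun (Fin n) ℂ
  have h : ∀ a, ∑ i, ‖⟪f i, b a⟫_ℂ‖ ^ 2 = 1 := fun a => by
    have h1 := hf.1.2 (b a)
    have h2 := hf.2 (b a)
    rw [b.orthonormal.1 a] at h1 h2
    linarith
  calc ∑ i, ‖f i‖ ^ 2 = ∑ i, ∑ a, ‖⟪f i, b a⟫_ℂ‖ ^ 2 :=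
        Finset.sum_congr rfl fun i _ => (b.sum_sq_norm_inner_left (f i)).symm
    _ = n := by rw [Finset.sum_comm]; simp [h]

/-- A projection matrix is the Gram matrix of a Parseval frame. -/
theorem exists_parseval_of_projection {X : Type*} [Fintype X] [DecidableEq X] {P : Matrix X X ℂ}
    (h1 : P.IsHermitian) (h2 : P * P = P) :
    ∃ n : ℕ, ∃ f : X → EuclideanSpace ℂ (Fin n), IsParsevalFrame f ∧
      (∀ x y, ⟪f x, f y⟫_ℂ = P x y) := by
  let S : Submodule ℂ (EuclideanSpace ℂ X) := LinearMap.range (Matrix.toEuclideanLin P)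
  let b := stdOrthonormalBasis ℂ S
  let V := b.repr
  have hfix : ∀ y : S, Matrix.toEuclideanLin P y = y := by
    rintro ⟨_, z, rfl⟩
    ext i
    simp [h2]
  -- The columns of P, seen in its range. Pairing with a vector y of the range returns the
  -- coordinate y x, whence the Parseval identity.
  let ex : X → S := fun x => ⟨Matrix.toEuclideanLin P (EuclideanSpace.single x 1), ⟨_, rfl⟩⟩
  have hsymm : ∀ u w, ⟪Matrix.toEuclideanLin P u, w⟫_ℂ = ⟪u, Matrix.toEuclideanLin P w⟫_ℂ :=
    Matrix.isSymmetric_toEuclideanLin_iff.2 h1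
  have hin : ∀ x (y : S), ⟪ex x, y⟫_ℂ = (y : EuclideanSpace ℂ X) x := by
    intro x y
    rw [Submodule.coe_inner, hsymm, hfix, EuclideanSpace.inner_single_left]
    simp
  have hpars : ∀ z, ∑ x, ‖⟪V (ex x), z⟫_ℂ‖ ^ 2 = ‖z‖ ^ 2 := by
    intro z
    obtain ⟨y, rfl⟩ := V.surjective z
    simp_rw [LinearIsometryEquiv.inner_map_map, hin, LinearIsometryEquiv.norm_map]
    rw [Submodule.coe_norm, EuclideanSpace.norm_sq_eq]
  refine ⟨_, fun x => V (ex x), ⟨⟨one_pos, fun z => ?_⟩, fun z => ?_⟩, fun x y => ?_⟩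
  · rw [hpars, one_mul]
  · rw [hpars, one_mul]
  · rw [LinearIsometryEquiv.inner_map_map, hin]
    simp [ex]

/-- A Bessel bound for a subfamily bounds the synthesis operator. -/
theorem IsBesselBound.norm_sum_smul_sq_le {ι H : Type*} [NormedAddCommGroup H]
    [InnerProductSpace ℂ H] {f : ι → H} {J : Finset ι} {B : ℝ} (h : IsBesselBound f J B)
    (hB : 0 ≤ B) (v : ι → ℂ) : ‖∑ i ∈ J, v i • f i‖ ^ 2 ≤ B * ∑ i ∈ J, ‖v i‖ ^ 2 := by
  set x := ∑ i ∈ J, v i • f i with hx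
  by_cases h0 : ‖x‖ = 0
  · rw [h0, zero_pow two_ne_zero]
    positivity
  have hpos : 0 < ‖x‖ ^ 2 := by positivity
  have e1 : ‖x‖ ^ 2 = ‖∑ i ∈ J, v i * ⟪x, f i⟫_ℂ‖ := by
    have : ⟪x, x⟫_ℂ = ∑ i ∈ J, v i * ⟪x, f i⟫_ℂ := by
      conv_lhs => rw [hx, inner_sum]
      exact Finset.sum_congr rfl fun i _ => inner_smul_right _ _ _
    rw [← this, inner_self_eq_norm_sq_to_K]
    simp
  have e2 : ‖x‖ ^ 2 ≤ ∑ i ∈ J, ‖v i‖ * ‖⟪f i, x⟫_ℂ‖ := by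
    rw [e1]
    refine (norm_sum_le _ _).trans (Finset.sum_le_sum fun i _ => ?_)
    rw [norm_mul, norm_inner_symm]
  have e3 := Finset.sum_mul_sq_le_sq_mul_sq J (fun i => ‖v i‖) (fun i => ‖⟪f i, x⟫_ℂ‖)
  have e4 : ‖x‖ ^ 2 * ‖x‖ ^ 2 ≤ (∑ i ∈ J, ‖v i‖ ^ 2) * (B * ‖x‖ ^ 2) := by
    calc ‖x‖ ^ 2 * ‖x‖ ^ 2 ≤ (∑ i ∈ J, ‖v i‖ * ‖⟪f i, x⟫_ℂ‖) ^ 2 := by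
          rw [sq (∑ i ∈ J, _)]; gcongr
      _ ≤ _ := e3
      _ ≤ _ := by gcongr; exact h x
  have : ‖x‖ ^ 2 * ‖x‖ ^ 2 ≤ (B * ∑ i ∈ J, ‖v i‖ ^ 2) * ‖x‖ ^ 2 := by linarith
  exact le_of_mul_le_mul_right this hpos

/-- If P is the Gram matrix of the frame, then ‖Pv‖² = ‖∑ v_x f_x‖², so a Bessel bound on a piece is
a paving bound on vectors supported there. The count |X| = K n comes from summing the squared norms.
-/
theorem BesselPartitionConjecture.exists_projectionPaving (h : BesselPartitionConjecture) :
    ∃ K₀ : ℕ, ∀ K : ℕ, K₀ ≤ K → 0 < K → ProjectionPaving K := by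
  obtain ⟨ε, hε, r, K₀, H⟩ := h
  refine ⟨K₀, fun K hK hpos => ⟨r, min ε 1, by positivity, fun X _ _ P h1 h2 h3 => ?_⟩⟩
  obtain ⟨n, f, hf, hin⟩ := exists_parseval_of_projection h1 h2
  have hKR : (K : ℝ) ≠ 0 := by exact_mod_cast hpos.ne'
  have hnorm : ∀ x, ‖f x‖ ^ 2 = (K : ℝ)⁻¹ := fun x => by
    have : ((‖f x‖ ^ 2 : ℝ) : ℂ) = ((K : ℝ)⁻¹ : ℝ) := by
      rw [Complex.ofReal_pow]
      refine (inner_self_eq_norm_sq_to_K (𝕜 := ℂ) (f x)).symm.trans ?_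
      rw [hin, h3]
      simp
    exact_mod_cast this
  have hcard : Fintype.card X = K * n := by
    have := hf.sum_norm_sq
    simp only [hnorm, Finset.sum_const, Finset.card_univ, nsmul_eq_mul] at this
    have h4 : (Fintype.card X : ℝ) = K * n := by rw [← this]; field_simp
    exact_mod_cast h4
  let g := (Fintype.equivFinOfCardEq hcard).symm
  obtain ⟨A, hA, hB⟩ := H K hK n (f ∘ g)
    (fun i j => by
      have : ‖f (g i)‖ ^ 2 = ‖f (g j)‖ ^ 2 := by rw [hnorm, hnorm]
      simpa using this)
    ⟨⟨one_pos, fun x => (hf.1.2 x).trans_eq (Equiv.sum_comp g fun y => ‖⟪f y, x⟫_ℂ‖ ^ 2).symm⟩,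
      fun x => (Equiv.sum_comp g fun y => ‖⟪f y, x⟫_ℂ‖ ^ 2).trans_le (hf.2 x)⟩
  choose c hc using fun x => hA.cover (g.symm x)
  refine ⟨c, fun j v hv => ?_⟩
  have hB' : IsBesselBound (f ∘ g) (A j) (1 - min ε 1) := fun x =>
    (hB j x).trans (mul_le_mul_of_nonneg_right (by linarith [min_le_left ε 1]) (by positivity))
  have hz : ∑ x, v x • f x = ∑ i ∈ A j, v (g i) • (f ∘ g) i := by
    rw [← Equiv.sum_comp g]
    refine (Finset.sum_subset (Finset.subset_univ _) fun i _ hi => ?_).symm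
    have : c (g i) ≠ j := fun h => hi (by have := hc (g i); rwa [h, Equiv.symm_apply_apply] at this)
    rw [hv _ this, zero_smul]
  have hPv : normSum (P.mulVec v) = ‖∑ x, v x • f x‖ ^ 2 := by
    have e1 : ∑ x, ‖⟪f x, ∑ y, v y • f y⟫_ℂ‖ ^ 2 = ‖∑ x, v x • f x‖ ^ 2 :=
      le_antisymm ((hf.2 _).trans_eq (one_mul _)) ((one_mul _).symm.trans_le (hf.1.2 _))
    rw [← e1, normSum]
    refine Finset.sum_congr rfl fun x _ => ?_
    rw [inner_sum, Matrix.mulVec, dotProduct]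
    congr 2
    exact Finset.sum_congr rfl fun y _ => by rw [inner_smul_right, hin, mul_comm]
  rw [hPv, hz]
  refine (hB'.norm_sum_smul_sq_le (by linarith [min_le_right ε 1]) fun i => v (g i)).trans ?_
  refine mul_le_mul_of_nonneg_left ?_ (by linarith [min_le_right ε 1])
  rw [normSum, ← Equiv.sum_comp g]
  exact Finset.sum_le_sum_of_subset_of_nonneg (Finset.subset_univ _) fun _ _ _ => by positivity

theorem BesselPartitionConjecture.projectionPaving_two (h : BesselPartitionConjecture) :
    ProjectionPaving 2 := by
  obtain ⟨K₀, H⟩ := h.exists_projectionPaving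
  exact ProjectionPaving.two_of_pow K₀
    (H _ ((Nat.lt_two_pow_self.trans Nat.lt_two_pow_self).le) (by positivity))

end Gram

/-! Paving of finite Hermitian contractions with zero diagonal -/

section HermitianPaving

variable {X : Type*} [Fintype X]

theorem normSum_eq_re (v : X → ℂ) : normSum v = (star v ⬝ᵥ v).re := by
  simp only [normSum, dotProduct, Complex.re_sum, Pi.star_apply, RCLike.star_def]
  refine Finset.sum_congr rfl fun x _ => ?_
  rw [← Complex.normSq_eq_norm_sq, mul_comm, Complex.mul_conj, Complex.ofReal_re]

theorem normSum_mulVec_projection {P : Matrix X X ℂ} (h1 : P.IsHermitian) (h2 : P * P = P)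
    (v : X → ℂ) : normSum (P.mulVec v) = (star v ⬝ᵥ P.mulVec v).re := by
  rw [normSum_eq_re, Matrix.star_mulVec, ← Matrix.dotProduct_mulVec, Matrix.mulVec_mulVec, h1.eq, h2]

theorem normSum_sum_elim_zero (u : X → ℂ) : normSum (Sum.elim u (0 : X → ℂ)) = normSum u := by
  simp [normSum]

variable [DecidableEq X]

/-- The form bound puts the eigenvalues l in [-1, 1], so √(1 - l²) in an eigenbasis of T serves. -/
theorem exists_sqrt_one_sub_sq {T : Matrix X X ℂ} (hT : T.IsHermitian)
    (hc : ∀ v, |(star v ⬝ᵥ T.mulVec v).re| ≤ normSum v) :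
    ∃ S : Matrix X X ℂ, S.IsHermitian ∧ S * S = 1 - T * T ∧ S * T = T * S := by
  have hl : ∀ i, |hT.eigenvalues i| ≤ 1 := by
    intro i
    have h1 := hc (hT.eigenvectorBasis i)
    have h2 := hT.eigenvalues_eq i
    simp only [RCLike.re_to_complex] at h2
    rw [← h2] at h1
    refine h1.trans_eq ?_
    rw [normSum, ← EuclideanSpace.norm_sq_eq, hT.eigenvectorBasis.orthonormal.1 i, one_pow]
  obtain ⟨l, Φ, hsp, hl⟩ : ∃ (l : X → ℝ) (Φ : Matrix X X ℂ ≃⋆ₐ[ℂ] Matrix X X ℂ),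
      T = Φ (Matrix.diagonal (RCLike.ofReal ∘ l)) ∧ ∀ i, |l i| ≤ 1 :=
    ⟨_, _, hT.spectral_theorem, hl⟩
  refine ⟨Φ (Matrix.diagonal fun i => (Real.sqrt (1 - l i ^ 2) : ℂ)), ?_, ?_, ?_⟩
  · rw [Matrix.IsHermitian, ← Matrix.star_eq_conjTranspose, ← map_star,
      Matrix.star_eq_conjTranspose, Matrix.diagonal_conjTranspose]
    congr 2
    ext i
    simp
  · rw [hsp, ← map_mul, ← map_mul, ← map_one Φ, ← map_sub, Matrix.diagonal_mul_diagonal,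
      Matrix.diagonal_mul_diagonal, ← Matrix.diagonal_one, Matrix.diagonal_sub]
    congr 2
    ext i
    have h3 : 0 ≤ 1 - l i ^ 2 := by
      have := (sq_le_one_iff_abs_le_one _).2 (hl i)
      linarith
    rw [← Complex.ofReal_mul, Real.mul_self_sqrt h3]
    simp [sq]
  · rw [hsp, ← map_mul, ← map_mul, Matrix.diagonal_mul_diagonal, Matrix.diagonal_mul_diagonal]
    congr 2
    ext i
    exact mul_comm _ _

/-- With S² = 1 - T² commuting with T, the block matrix ½[[1 + T, S], [S, 1 - T]] is a projection
with diagonal 1/2. Its form at (u, 0) is ½(‖u‖² + ⟨u, Tu⟩), so a bound (1 - ε)‖u‖² there becomes 1 -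
2ε for T. -/
theorem ProjectionPaving.exists_upper_paving (h : ProjectionPaving 2) :
    ∃ r : ℕ, ∃ ε : ℝ, 0 < ε ∧ ∀ (X : Type) [Fintype X] [DecidableEq X] (T : Matrix X X ℂ),
      T.IsHermitian → (∀ x, T x x = 0) → (∀ v, |(star v ⬝ᵥ T.mulVec v).re| ≤ normSum v) →
        ∃ c : X → Fin r, ∀ j, ∀ v : X → ℂ, (∀ x, c x ≠ j → v x = 0) →
          (star v ⬝ᵥ T.mulVec v).re ≤ (1 - ε) * normSum v := by
  obtain ⟨r, ε, hε, H⟩ := h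
  refine ⟨r, 2 * ε, by positivity, fun X _ _ T hT hd hc => ?_⟩
  obtain ⟨S, hS, hSS, hST⟩ := exists_sqrt_one_sub_sq hT hc
  set P : Matrix (X ⊕ X) (X ⊕ X) ℂ := (2⁻¹ : ℂ) • Matrix.fromBlocks (1 + T) S S (1 - T) with hP
  have hP1 : P.IsHermitian := by
    rw [Matrix.IsHermitian, hP, Matrix.conjTranspose_smul, Matrix.fromBlocks_conjTranspose]
    simp [hT.eq, hS.eq]
  have hP2 : P * P = P := by
    rw [hP, smul_mul_smul_comm, Matrix.fromBlocks_multiply]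
    have e1 : (1 + T) * (1 + T) + S * S = (2 : ℂ) • (1 + T) := by
      rw [hSS, two_smul]; noncomm_ring
    have e2 : (1 + T) * S + S * (1 - T) = (2 : ℂ) • S := by
      rw [add_mul, mul_sub, hST, two_smul]; noncomm_ring
    have e3 : S * (1 + T) + (1 - T) * S = (2 : ℂ) • S := by
      rw [mul_add, sub_mul, hST, two_smul]; noncomm_ring
    have e4 : S * S + (1 - T) * (1 - T) = (2 : ℂ) • (1 - T) := by
      rw [hSS, two_smul]; noncomm_ring
    rw [e1, e2, e3, e4, ← Matrix.fromBlocks_smul, smul_smul]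
    norm_num
  obtain ⟨c, hc⟩ := H (X ⊕ X) P hP1 hP2 (by
    rintro (x | x) <;> simp [hP, hd])
  refine ⟨fun x => c (Sum.inl x), fun j u hu => ?_⟩
  have := hc j (Sum.elim u 0) (by
    rintro (x | x) hx
    · exact hu x hx
    · rfl)
  rw [normSum_mulVec_projection hP1 hP2, normSum_sum_elim_zero] at this
  have e : (star (Sum.elim u (0 : X → ℂ)) ⬝ᵥ P.mulVec (Sum.elim u 0)).re
      = 2⁻¹ * (normSum u + (star u ⬝ᵥ T.mulVec u).re) := by
    have hstar : star (Sum.elim u (0 : X → ℂ)) = Sum.elim (star u) 0 := by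
      ext (x | x) <;> simp
    rw [hP, Matrix.smul_mulVec, Matrix.fromBlocks_mulVec, dotProduct_smul, hstar,
      sumElim_dotProduct_sumElim, normSum_eq_re]
    simp [Matrix.add_mulVec, dotProduct_add]
  rw [e] at this
  linarith

/-- The common refinement of upper pavings of T and -T bounds the form on both sides. -/
theorem ProjectionPaving.exists_paving (h : ProjectionPaving 2) :
    ∃ r : ℕ, ∃ ε : ℝ, 0 < ε ∧ ∀ (X : Type) [Fintype X] [DecidableEq X] (T : Matrix X X ℂ),
      T.IsHermitian → (∀ x, T x x = 0) → (∀ v, |(star v ⬝ᵥ T.mulVec v).re| ≤ normSum v) →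
        ∃ c : X → Fin r, ∀ j, ∀ v : X → ℂ, (∀ x, c x ≠ j → v x = 0) →
          |(star v ⬝ᵥ T.mulVec v).re| ≤ (1 - ε) * normSum v := by
  obtain ⟨r, ε, hε, H⟩ := h.exists_upper_paving
  refine ⟨r * r, ε, hε, fun X _ _ T hT hd hb => ?_⟩
  obtain ⟨c₁, h₁⟩ := H X T hT hd hb
  obtain ⟨c₂, h₂⟩ := H X (-T) hT.neg (by simpa using hd) (by simpa [Matrix.neg_mulVec] using hb)
  refine ⟨fun x => finProdFinEquiv (c₁ x, c₂ x), fun j v hv => ?_⟩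
  have a1 := h₁ (finProdFinEquiv.symm j).1 v fun x hx => hv x fun h => hx (by rw [← h]; simp)
  have a2 := h₂ (finProdFinEquiv.symm j).2 v fun x hx => hv x fun h => hx (by rw [← h]; simp)
  rw [Matrix.neg_mulVec, dotProduct_neg, Complex.neg_re] at a2
  exact abs_le.2 ⟨by linarith, a1⟩

end HermitianPaving

/-! Paving of operators on `ℓ₂` -/

section InfinitePaving

theorem single_eq_smul_e (i : ℕ) (a : ℂ) : (lp.single 2 i a : Ell2) = a • e i := by
  ext k
  by_cases h : k = i
  · subst h; simp [e]
  · simp [e, h]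

theorem tendsto_sum_smul_e (x : Ell2) :
    Filter.Tendsto (fun n => ∑ i ∈ Finset.range n, x i • e i) Filter.atTop (nhds x) := by
  have := (lp.hasSum_single (p := 2) (by simp) x).tendsto_sum_nat
  simpa only [single_eq_smul_e] using this

theorem inner_e_e (i j : ℕ) : ⟪e i, e j⟫_ℂ = if i = j then 1 else 0 := by
  rw [inner_e, e_apply]

theorem norm_sum_smul_e_sq {n : ℕ} (v : Fin n → ℂ) :
    ‖∑ a : Fin n, v a • e a‖ ^ 2 = normSum v := by
  have h : ((‖∑ a : Fin n, v a • e a‖ ^ 2 : ℝ) : ℂ) = ((star v ⬝ᵥ v : ℂ)) := by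
    rw [Complex.ofReal_pow]
    refine (inner_self_eq_norm_sq_to_K (𝕜 := ℂ) (∑ a : Fin n, v a • e a : Ell2)).symm.trans ?_
    rw [sum_inner]
    refine Finset.sum_congr rfl fun a _ => ?_
    rw [inner_sum, Finset.sum_eq_single a]
    · rw [inner_smul_left, inner_smul_right, inner_e_e, if_pos rfl, mul_one]
      rfl
    · intro b _ hb
      have : (a : ℕ) ≠ b := fun h => hb (Fin.ext h.symm)
      simp [inner_smul_left, inner_smul_right, inner_e_e, this]
    · simp
  rw [normSum_eq_re, ← h, Complex.ofReal_re]

/-- The `n × n` upper left corner of the matrix of an operator. -/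
noncomputable def corner (T : Ell2 →L[ℂ] Ell2) (n : ℕ) : Matrix (Fin n) (Fin n) ℂ :=
  Matrix.of fun a b => T (e b) a

theorem corner_form (T : Ell2 →L[ℂ] Ell2) {n : ℕ} (v : Fin n → ℂ) :
    star v ⬝ᵥ (corner T n).mulVec v
      = ⟪∑ a : Fin n, v a • e a, T (∑ a : Fin n, v a • e a)⟫_ℂ := by
  rw [sum_inner, map_sum]
  refine Finset.sum_congr rfl fun a _ => ?_
  rw [inner_sum, Matrix.mulVec, dotProduct, Finset.mul_sum]
  refine Finset.sum_congr rfl fun b _ => ?_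
  rw [map_smul, inner_smul_left, inner_smul_right, inner_e]
  simp [corner, mul_comm]

theorem corner_isHermitian {T : Ell2 →L[ℂ] Ell2} (hT : IsSelfAdjoint T) (n : ℕ) :
    (corner T n).IsHermitian := by
  ext a b
  simp only [corner, Matrix.conjTranspose_apply, Matrix.of_apply, RCLike.star_def]
  rw [← inner_e, inner_conj_symm, ← ContinuousLinearMap.adjoint_inner_right,
    ← ContinuousLinearMap.star_eq_adjoint, hT.star_eq, inner_e]

/-- Colourings of the finite corners have a limit in the compact space of colourings of ℕ. On any
finite set the limit agrees with arbitrarily large corners, and finitely supported vectors are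
dense. -/
theorem ProjectionPaving.exists_operator_paving (h : ProjectionPaving 2) :
    ∃ r : ℕ, ∃ ε : ℝ, 0 < ε ∧ ε ≤ 1 ∧ ∀ T : Ell2 →L[ℂ] Ell2, IsSelfAdjoint T →
      (∀ i, T (e i) i = 0) → (∀ x, |(⟪x, T x⟫_ℂ).re| ≤ ‖x‖ ^ 2) →
        ∃ c : ℕ → Fin r, ∀ j, ∀ x : Ell2, (∀ i, c i ≠ j → x i = 0) →
          |(⟪x, T x⟫_ℂ).re| ≤ (1 - ε) * ‖x‖ ^ 2 := by
  obtain ⟨r, ε, hε, H⟩ := h.exists_paving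
  refine ⟨r, min ε 1, by positivity, min_le_right _ _, fun T hT hd hb => ?_⟩
  choose c hc using fun n : ℕ => H (Fin (n + 1)) (corner T (n + 1)) (corner_isHermitian hT _)
    (fun a => hd a) (fun v => by rw [corner_form, ← norm_sum_smul_e_sq]; exact hb _)
  -- Indices beyond n wrap around; those values are never used, since only i < m ≤ n matters below.
  let F : ℕ → ℕ → Fin r := fun n i => c n (Fin.ofNat (n + 1) i)
  obtain ⟨d, -, hdlim⟩ := isCompact_univ.ultrafilter_le_nhds
    ((Filter.hyperfilter ℕ).map F) (by simp)
  have hev : ∀ i, ∀ᶠ n in (Filter.hyperfilter ℕ : Filter ℕ), F n i = d i := fun i =>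
    by
    have h : Filter.Tendsto (fun g : ℕ → Fin r => g i) (nhds d) (nhds (d i)) :=
      (continuous_apply i).continuousAt
    exact hdlim (h (IsOpen.mem_nhds (isOpen_discrete {d i}) rfl))
  refine ⟨d, fun j x hx => ?_⟩
  have hfin : ∀ m, |(⟪∑ i ∈ Finset.range m, x i • e i,
      T (∑ i ∈ Finset.range m, x i • e i)⟫_ℂ).re|
        ≤ (1 - min ε 1) * ‖∑ i ∈ Finset.range m, x i • e i‖ ^ 2 := by
    intro m
    have h1 : ∀ᶠ n in (Filter.hyperfilter ℕ : Filter ℕ), ∀ i ∈ Finset.range m, F n i = d i :=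
      (Filter.eventually_all_finset _).2 fun i _ => hev i
    have h2 : ∀ᶠ n in (Filter.hyperfilter ℕ : Filter ℕ), m ≤ n :=
      Nat.hyperfilter_le_atTop (Filter.eventually_ge_atTop m)
    obtain ⟨n, hn, hmn⟩ := (h1.and h2).exists
    let v : Fin (n + 1) → ℂ := fun a => if (a : ℕ) < m then x a else 0
    have hv : ∑ a : Fin (n + 1), v a • e a = ∑ i ∈ Finset.range m, x i • e i := by
      rw [Fin.sum_univ_eq_sum_range (fun i => (if i < m then x i else 0) • e i) (n + 1)]
      rw [← Finset.sum_subset (Finset.range_subset_range.2 (hmn.trans n.le_succ))]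
      · exact Finset.sum_congr rfl fun i hi => by rw [if_pos (Finset.mem_range.1 hi)]
      · intro i _ hi
        rw [if_neg (by simpa using hi), zero_smul]
    have := hc n j v (by
      intro a ha
      by_cases ham : (a : ℕ) < m
      · have h3 := hn a (Finset.mem_range.2 ham)
        have h4 : Fin.ofNat (n + 1) (a : ℕ) = a := by simp
        simp only [F, h4] at h3
        simp only [v, if_pos ham]
        exact hx _ (h3 ▸ ha)
      · simp [v, ham])
    rw [corner_form, ← norm_sum_smul_e_sq, hv] at this
    refine this.trans (mul_le_mul_of_nonneg_right ?_ (by positivity))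
    linarith [min_le_left ε 1]
  have hlim := tendsto_sum_smul_e x
  refine le_of_tendsto_of_tendsto' (b := Filter.atTop) ?_ ?_ hfin
  · exact (Complex.continuous_re.tendsto _ |>.comp
      (hlim.inner ((T.continuous.tendsto x).comp hlim))).abs
  · exact (hlim.norm.pow 2).const_mul _

end InfinitePaving

/-! Uniqueness of state extensions from paving -/

section Uniqueness

/-- The diagonal projection onto the coordinates in `Y`. -/
noncomputable def coordProj (Y : Set ℕ) : Ell2 →L[ℂ] Ell2 :=
  diagOp (Y.indicator 1) zero_le_one fun i => by
    by_cases h : i ∈ Y <;> simp [h]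

theorem coordProj_apply (Y : Set ℕ) (x : Ell2) (i : ℕ) :
    coordProj Y x i = Y.indicator 1 i * x i :=
  diagOp_apply _ _ _ _ _

theorem coordProj_mul_self (Y : Set ℕ) : coordProj Y * coordProj Y = coordProj Y := by
  ext x i
  by_cases h : i ∈ Y <;> simp [coordProj_apply, h]

theorem inner_coordProj (Y : Set ℕ) (x y : Ell2) : ⟪coordProj Y x, y⟫_ℂ = ⟪x, coordProj Y y⟫_ℂ := by
  rw [lp.inner_eq_tsum, lp.inner_eq_tsum]
  refine tsum_congr fun i => ?_
  by_cases h : i ∈ Y <;> simp [coordProj_apply, h]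

theorem star_coordProj (Y : Set ℕ) : star (coordProj Y) = coordProj Y := by
  rw [ContinuousLinearMap.star_eq_adjoint, eq_comm, ContinuousLinearMap.eq_adjoint_iff]
  exact inner_coordProj Y

theorem norm_coordProj_le (Y : Set ℕ) (x : Ell2) : ‖coordProj Y x‖ ≤ ‖x‖ := by
  have h : ‖coordProj Y‖ ≤ 1 := by
    unfold coordProj diagOp
    exact lp.norm_mapCLM_le 2 _ _ _
  simpa using (coordProj Y).le_of_opNorm_le h x

/-- The diagonal projection onto the coordinates in `Y`, as an element of the diagonal algebra. -/
noncomputable def diagProj (Y : Set ℕ) : diagonalAlgebra :=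
  ⟨coordProj Y, isDiagonal_diagOp _ _ _⟩

theorem diagProj_compl (Y : Set ℕ) : diagProj Yᶜ = 1 - diagProj Y := by
  apply Subtype.ext
  ext x i
  change coordProj Yᶜ x i = x i - coordProj Y x i
  by_cases h : i ∈ Y <;> simp [coordProj_apply, h]

theorem diagProj_mul_nonneg (Y : Set ℕ) {T : diagonalAlgebra} (hT : 0 ≤ T) :
    0 ≤ diagProj Y * T := by
  have h : diagProj Y * T = star (diagProj Y) * T * diagProj Y := by
    apply Subtype.ext
    ext x i
    change coordProj Y ((T : Ell2 →L[ℂ] Ell2) x) i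
      = star (coordProj Y) ((T : Ell2 →L[ℂ] Ell2) (coordProj Y x)) i
    rw [star_coordProj, coordProj_apply, coordProj_apply, IsDiagonal.apply T.2 x,
      IsDiagonal.apply T.2 (coordProj Y x), coordProj_apply]
    by_cases h : i ∈ Y <;> simp [h]
  rw [h]
  exact star_left_conjugate_nonneg (R := Ell2 →L[ℂ] Ell2) hT (coordProj Y)

theorem IsPureState.diagProj_eq {φ : diagonalAlgebra →ₗ[ℂ] ℂ} (hφ : IsPureState φ) (Y : Set ℕ) :
    φ (diagProj Y) = 0 ∨ φ (diagProj Y) = 1 := by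
  refine hφ.eq_zero_or_eq_one (Subtype.ext (coordProj_mul_self Y)) ?_
    (fun T hT => diagProj_mul_nonneg Y hT) (fun T hT => ?_)
  · simpa using star_mul_self_nonneg_diagonal 1
  · rw [← diagProj_compl]
    exact diagProj_mul_nonneg _ hT

/-- The colour projections sum to one and φ is 0 or 1 on each. -/
theorem IsPureState.exists_color {φ : diagonalAlgebra →ₗ[ℂ] ℂ} (hφ : IsPureState φ) {r : ℕ}
    (c : ℕ → Fin r) : ∃ j, φ (diagProj {i | c i = j}) = 1 := by
  by_contra h
  push Not at h
  have h0 : ∀ j, φ (diagProj {i | c i = j}) = 0 := fun j =>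
    (hφ.diagProj_eq _).resolve_right (h j)
  have hsum : ∑ j, diagProj {i | c i = j} = 1 := by
    apply Subtype.ext
    ext x i
    rw [AddSubmonoidClass.coe_finsetSum, sum_apply, lp.coeFn_sum, Finset.sum_apply]
    simp [diagProj, coordProj_apply, Set.indicator_apply]
  have := hφ.1.1
  rw [← hsum, map_sum] at this
  simp [h0] at this

/-- Lets positivity alone show that a state vanishing on the projection Q onto Z also vanishes on
(SQ)*(SQ). -/
theorem norm_sq_smul_coordProj_sub_nonneg (S : Ell2 →L[ℂ] Ell2) (Z : Set ℕ) :
    0 ≤ ((‖S‖ ^ 2 : ℝ) : ℂ) • coordProj Z - star (S * coordProj Z) * (S * coordProj Z) := by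
  rw [ContinuousLinearMap.nonneg_iff_isPositive, ContinuousLinearMap.isPositive_def']
  refine ⟨IsSelfAdjoint.sub ?_ (.star_mul_self _), fun x => ?_⟩
  · rw [isSelfAdjoint_iff, star_smul, star_coordProj]
    simp
  · rw [ContinuousLinearMap.reApplyInnerSelf_apply, ← inner_re_symm]
    have e1 : ⟪x, coordProj Z x⟫_ℂ = ((‖coordProj Z x‖ ^ 2 : ℝ) : ℂ) := by
      have : coordProj Z x = coordProj Z (coordProj Z x) :=
        (congrArg (fun A : Ell2 →L[ℂ] Ell2 => A x) (coordProj_mul_self Z)).symm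
      rw [this, ← inner_coordProj, ← this, inner_self_eq_norm_sq_to_K]
      simp
    have e2 : ⟪x, (star (S * coordProj Z) * (S * coordProj Z)) x⟫_ℂ
        = ((‖S (coordProj Z x)‖ ^ 2 : ℝ) : ℂ) := by
      change ⟪x, star (S * coordProj Z) (S (coordProj Z x))⟫_ℂ = _
      rw [ContinuousLinearMap.star_eq_adjoint, ContinuousLinearMap.adjoint_inner_right]
      change ⟪S (coordProj Z x), S (coordProj Z x)⟫_ℂ = _
      rw [inner_self_eq_norm_sq_to_K]
      simp
    rw [sub_apply, smul_apply, inner_sub_right, inner_smul_right, e1, e2, ← Complex.ofReal_mul,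
      ← Complex.ofReal_sub, RCLike.re_to_complex, Complex.ofReal_re, sub_nonneg, ← mul_pow]
    gcongr
    exact S.le_opNorm _

/-- A state that equals one on a coordinate projection is concentrated there. -/
theorem IsState.compress {ψ : (Ell2 →L[ℂ] Ell2) →ₗ[ℂ] ℂ} (hψ : IsState ψ) {Y : Set ℕ}
    (hY : ψ (coordProj Y) = 1) (T : Ell2 →L[ℂ] Ell2) :
    ψ T = ψ (coordProj Y * T * coordProj Y) := by
  have hR := star_mul_self_nonneg_operator
  have hcompl : coordProj Yᶜ = 1 - coordProj Y := congrArg Subtype.val (diagProj_compl Y)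
  have hψc : ψ (coordProj Yᶜ) = 0 := by rw [hcompl, map_sub, hψ.1, hY, sub_self]
  have key : ∀ S : Ell2 →L[ℂ] Ell2, ψ (S * coordProj Yᶜ) = 0 := by
    intro S
    refine hψ.eq_zero_of_star_mul_self hR ?_
    have h2 := hψ.2 _ (norm_sq_smul_coordProj_sub_nonneg S Yᶜ)
    rw [map_sub, map_smul, hψc, smul_zero, zero_sub] at h2
    simpa using (Complex.nonneg_iff.1 h2).1
  have k1 := key (coordProj Y * T)
  have k2 := key (star T)
  rw [← star_coordProj Yᶜ, ← star_mul, hψ.map_star hR, star_eq_zero, hcompl, sub_mul, one_mul,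
    map_sub] at k2
  rw [hcompl, mul_sub, mul_one, map_sub] at k1
  linear_combination k1 + k2

/-- Both C - T and C + T are positive, and ψ(T) is real. -/
theorem norm_apply_le_of_form {ψ : (Ell2 →L[ℂ] Ell2) →ₗ[ℂ] ℂ} (hψ : IsState ψ)
    {T : Ell2 →L[ℂ] Ell2} (hT : IsSelfAdjoint T) {C : ℝ}
    (h : ∀ x, |(⟪x, T x⟫_ℂ).re| ≤ C * ‖x‖ ^ 2) : ‖ψ T‖ ≤ C := by
  have key : ∀ S : Ell2 →L[ℂ] Ell2, IsSelfAdjoint S → (∀ x, (⟪x, S x⟫_ℂ).re ≤ C * ‖x‖ ^ 2) →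
      (ψ S).re ≤ C := by
    intro S hS hb
    have hpos : 0 ≤ (C : ℂ) • (1 : Ell2 →L[ℂ] Ell2) - S := by
      rw [ContinuousLinearMap.nonneg_iff_isPositive, ContinuousLinearMap.isPositive_def']
      refine ⟨IsSelfAdjoint.sub ?_ hS, fun x => ?_⟩
      · rw [isSelfAdjoint_iff, star_smul, star_one]
        simp
      · rw [ContinuousLinearMap.reApplyInnerSelf_apply, ← inner_re_symm]
        have : (⟪x, ((C : ℂ) • (1 : Ell2 →L[ℂ] Ell2) - S) x⟫_ℂ)
            = ((C * ‖x‖ ^ 2 : ℝ) : ℂ) - ⟪x, S x⟫_ℂ := by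
          rw [sub_apply, smul_apply, one_apply_eq_self, inner_sub_right, inner_smul_right,
            inner_self_eq_norm_sq_to_K]
          push_cast
          rfl
        rw [this, RCLike.re_to_complex, Complex.sub_re, Complex.ofReal_re]
        linarith [hb x]
    have := (Complex.nonneg_iff.1 (hψ.2 _ hpos)).1
    simp [hψ.1] at this
    linarith
  have h1 := key T hT fun x => (le_abs_self _).trans (h x)
  have h2 := key (-T) hT.neg fun x => by
    simpa using (neg_le_abs _).trans (h x)
  have him : (ψ T).im = 0 := by
    have := hψ.map_star star_mul_self_nonneg_operator T
    rw [hT.star_eq] at this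
    exact Complex.conj_eq_iff_im.1 this.symm
  rw [← Complex.re_add_im (ψ T), him]
  simp at h2 ⊢
  exact abs_le.2 ⟨by linarith, h1⟩

/-- Compressing T to the colour class where φ is one leaves ψ(T) and the zero diagonal unchanged but
shrinks the form bound by a fixed factor; this can be repeated indefinitely. -/
theorem ProjectionPaving.state_eq_zero (h : ProjectionPaving 2) {φ : diagonalAlgebra →ₗ[ℂ] ℂ}
    (hφ : IsPureState φ) {ψ : (Ell2 →L[ℂ] Ell2) →ₗ[ℂ] ℂ} (hψ : IsState ψ) (hext : Extends ψ φ)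
    {T : Ell2 →L[ℂ] Ell2} (hT : IsSelfAdjoint T) (hd : ∀ i, T (e i) i = 0) : ψ T = 0 := by
  obtain ⟨r, ε, hε, hε1, H⟩ := h.exists_operator_paving
  have key : ∀ k : ℕ, ∀ T : Ell2 →L[ℂ] Ell2, ∀ C : ℝ, 0 < C → IsSelfAdjoint T →
      (∀ i, T (e i) i = 0) → (∀ x, |(⟪x, T x⟫_ℂ).re| ≤ C * ‖x‖ ^ 2) →
      ‖ψ T‖ ≤ (1 - ε / 2) ^ k * C := by
    intro k
    induction k with
    | zero =>
      intro T C _ hT _ hb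
      simpa using norm_apply_le_of_form hψ hT hb
    | succ k ih =>
      intro T C hC hT hd hb
      have hform : ∀ x, (⟪x, ((C⁻¹ : ℝ) : ℂ) • T x⟫_ℂ).re = C⁻¹ * (⟪x, T x⟫_ℂ).re := fun x => by
        rw [inner_smul_right, Complex.re_ofReal_mul]
      obtain ⟨c, hc⟩ := H (((C⁻¹ : ℝ) : ℂ) • T)
        (by rw [isSelfAdjoint_iff, star_smul, hT.star_eq]; simp)
        (fun i => by simp [hd i])
        (fun x => by
          rw [smul_apply, hform, abs_mul, abs_of_pos (inv_pos.2 hC)]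
          rw [inv_mul_le_iff₀ hC]
          exact hb x)
      obtain ⟨j, hj⟩ := hφ.exists_color c
      set Y : Set ℕ := {i | c i = j} with hY
      rw [hψ.compress ((hext (diagProj Y)).trans hj) T, pow_succ,
        mul_assoc ((1 - ε / 2) ^ k)]
      -- The factor 1 - ε/2 replaces 1 - ε, which may be zero, because the next round divides by the
      -- new bound.
      refine ih _ _ (mul_pos (by linarith) hC) ?_ (fun i => ?_) (fun x => ?_)
      · rw [isSelfAdjoint_iff, star_mul, star_mul, star_coordProj, hT.star_eq, mul_assoc]
      · have hQe : coordProj Y (e i) = (Y.indicator 1 i : ℂ) • e i := by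
          ext k
          rw [coordProj_apply, lp.coeFn_smul, Pi.smul_apply, e_apply]
          by_cases hk : k = i
          · simp [hk]
          · simp [hk]
        change coordProj Y (T (coordProj Y (e i))) i = 0
        rw [coordProj_apply, hQe, map_smul]
        simp [hd i]
      · have h1 := hc j (coordProj Y x) (fun i hi => by
          rw [coordProj_apply, Set.indicator_of_notMem (by simpa [hY] using hi), zero_mul])
        rw [smul_apply, hform, abs_mul, abs_of_pos (inv_pos.2 hC), inv_mul_le_iff₀ hC] at h1
        change |(⟪x, coordProj Y (T (coordProj Y x))⟫_ℂ).re| ≤ _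
        rw [← inner_coordProj]
        refine h1.trans ?_
        have h2 := pow_le_pow_left₀ (norm_nonneg _) (norm_coordProj_le Y x) 2
        calc C * ((1 - ε) * ‖coordProj Y x‖ ^ 2) ≤ C * ((1 - ε / 2) * ‖x‖ ^ 2) :=
              mul_le_mul_of_nonneg_left
                (mul_le_mul (by linarith) h2 (by positivity) (by linarith)) hC.le
          _ = _ := by ring
  have hb : ∀ x, |(⟪x, T x⟫_ℂ).re| ≤ (‖T‖ + 1) * ‖x‖ ^ 2 := fun x =>
    calc |(⟪x, T x⟫_ℂ).re| ≤ ‖⟪x, T x⟫_ℂ‖ := Complex.abs_re_le_norm _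
      _ ≤ ‖x‖ * ‖T x‖ := norm_inner_le_norm _ _
      _ ≤ ‖x‖ * (‖T‖ * ‖x‖) := by gcongr; exact T.le_opNorm x
      _ ≤ (‖T‖ + 1) * ‖x‖ ^ 2 := by nlinarith [sq_nonneg ‖x‖]
  have hlim : Filter.Tendsto (fun k : ℕ => (1 - ε / 2) ^ k * (‖T‖ + 1)) Filter.atTop (nhds 0) := by
    simpa using (tendsto_pow_atTop_nhds_zero_of_lt_one (r := 1 - ε / 2) (by linarith)
      (by linarith)).mul_const (‖T‖ + 1)
  have := ge_of_tendsto' hlim fun k => key k T (‖T‖ + 1) (by positivity) hT hd hb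
  exact norm_le_zero_iff.1 this

/-- The operator `T - diagPart T` has zero diagonal, and its self-adjoint and skew parts are treated
separately. -/
theorem ProjectionPaving.extension_eq (h : ProjectionPaving 2) {φ : diagonalAlgebra →ₗ[ℂ] ℂ}
    (hφ : IsPureState φ) {ψ : (Ell2 →L[ℂ] Ell2) →ₗ[ℂ] ℂ} (hψ : IsState ψ) (hext : Extends ψ φ) :
    ψ = φ.comp diagPart := by
  have hzero : ∀ T : Ell2 →L[ℂ] Ell2, (∀ i, T (e i) i = 0) → ψ T = 0 := by
    intro T hd
    have hd' : ∀ i, star T (e i) i = 0 := fun i => by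
      rw [← inner_e, ContinuousLinearMap.star_eq_adjoint, ContinuousLinearMap.adjoint_inner_right,
        ← inner_conj_symm, inner_e, hd, map_zero]
    have h1 := h.state_eq_zero hφ hψ hext (T := T + star T) (.add_star_self T)
      (fun i => by simp [hd i, hd' i])
    have h2 := h.state_eq_zero hφ hψ hext (T := Complex.I • (T - star T))
      (by rw [isSelfAdjoint_iff, star_smul, star_sub, star_star]; simp [← smul_neg])
      (fun i => by
        rw [smul_apply, sub_apply, lp.coeFn_smul, Pi.smul_apply, lp.coeFn_sub, Pi.sub_apply, hd i,
          hd' i, sub_zero, smul_zero])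
    rw [map_smul, smul_eq_zero_iff_right Complex.I_ne_zero, map_sub] at h2
    rw [map_add] at h1
    linear_combination (h1 + h2) / 2
  ext T
  have := hzero (T - diagPart T) fun i => by
    rw [sub_apply, lp.coeFn_sub, Pi.sub_apply, diagPart_apply, e_apply, if_pos rfl, mul_one, sub_self]
  rw [map_sub, sub_eq_zero] at this
  rw [this, hext, LinearMap.comp_apply]

theorem ProjectionPaving.kadisonSingerProperty (h : ProjectionPaving 2) :
    KadisonSingerProperty := by
  intro φ hφ
  refine ⟨φ.comp diagPart, ?_, extends_comp_diagPart φ, fun ψ hψ hext => h.extension_eq hφ hψ hext⟩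
  refine mem_extremePoints_iff_left.2 ⟨hφ.1.comp_diagPart,
    fun ψ₁ h₁ ψ₂ h₂ ⟨a, b, ha, hb, hab, hs⟩ => ?_⟩
  let ι : diagonalAlgebra →ₗ[ℂ] (Ell2 →L[ℂ] Ell2) := diagonalAlgebra.subtype.toAlgHom.toLinearMap
  have hres : ∀ {ψ : (Ell2 →L[ℂ] Ell2) →ₗ[ℂ] ℂ}, IsState ψ → IsState (ψ.comp ι) := fun hψ =>
    ⟨hψ.1, fun T hT => hψ.2 _ hT⟩
  -- Purity of the extension: the components restrict to φ because φ is extreme, hence are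
  -- extensions of it, and uniqueness applies.
  have := (mem_extremePoints_iff_left.1 hφ).2 _ (hres h₁) _ (hres h₂) ⟨a, b, ha, hb, hab, by
    ext T
    have := LinearMap.congr_fun hs (T : Ell2 →L[ℂ] Ell2)
    rw [LinearMap.comp_apply, diagPart_coe] at this
    exact this⟩
  exact h.extension_eq hφ h₁ fun T => LinearMap.congr_fun this T

end Uniqueness

/-! Limits of vector states -/

section LimitStates

theorem exists_limit_state (W : Ultrafilter Ell2) (h : ∀ᶠ v in (W : Filter Ell2), ‖v‖ = 1) :
    ∃ ψ : (Ell2 →L[ℂ] Ell2) →ₗ[ℂ] ℂ, IsState ψ ∧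
      ∀ T, Filter.Tendsto (fun v => ⟪v, T v⟫_ℂ) W (nhds (ψ T)) := by
  have hex : ∀ T : Ell2 →L[ℂ] Ell2, ∃ z, Filter.Tendsto (fun v => ⟪v, T v⟫_ℂ) W (nhds z) := by
    intro T
    have hb : ∀ᶠ v in (W : Filter Ell2), ⟪v, T v⟫_ℂ ∈ Metric.closedBall (0 : ℂ) ‖T‖ := by
      filter_upwards [h] with v hv
      rw [mem_closedBall_zero_iff]
      refine (norm_inner_le_norm _ _).trans ?_
      rw [hv, one_mul]
      simpa [hv] using T.le_opNorm v
    obtain ⟨z, -, hz⟩ := (isCompact_closedBall (0 : ℂ) ‖T‖).ultrafilter_le_nhds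
      (W.map fun v => ⟪v, T v⟫_ℂ) (Filter.le_principal_iff.2 hb)
    exact ⟨z, hz⟩
  choose ψ hψ using hex
  refine ⟨⟨⟨ψ, fun S T => ?_⟩, fun c T => ?_⟩, ⟨?_, fun T hT => ?_⟩, hψ⟩
  · refine tendsto_nhds_unique (hψ _) (((hψ S).add (hψ T)).congr fun v => ?_)
    rw [add_apply, inner_add_right]
  · refine tendsto_nhds_unique (hψ _) (((hψ T).const_mul c).congr fun v => ?_)
    rw [smul_apply, inner_smul_right]
  · refine tendsto_nhds_unique (hψ 1) (tendsto_const_nhds.congr' ?_)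
    filter_upwards [h] with v hv
    rw [one_apply_eq_self, inner_self_eq_norm_sq_to_K, hv]
    simp
  · refine ge_of_tendsto' (hψ T) fun v => ?_
    exact ((ContinuousLinearMap.nonneg_iff_isPositive T).1 hT).inner_nonneg_right v

theorem inner_e_apply_e (T : Ell2 →L[ℂ] Ell2) (i : ℕ) : ⟪e i, T (e i)⟫_ℂ = T (e i) i :=
  inner_e _ _

/-- The inclusion of the diagonal algebra. -/
noncomputable def diagInclusion : diagonalAlgebra →ₗ[ℂ] (Ell2 →L[ℂ] Ell2) :=
  diagonalAlgebra.subtype.toAlgHom.toLinearMap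

/-- The limit of diagonal entries along an ultrafilter is a pure state of the diagonal algebra. -/
theorem isPureState_of_tendsto {U : Ultrafilter ℕ} {ψ : (Ell2 →L[ℂ] Ell2) →ₗ[ℂ] ℂ}
    (hψ : IsState ψ) (hlim : ∀ T : Ell2 →L[ℂ] Ell2,
      Filter.Tendsto (fun i => T (e i) i) U (nhds (ψ T))) :
    IsPureState (ψ.comp diagInclusion) := by
  refine IsState.isPureState (φ := ψ.comp diagInclusion) ⟨hψ.1, fun T hT => hψ.2 _ hT⟩
    star_mul_self_nonneg_diagonal fun D hD => ?_
  change ψ (D : Ell2 →L[ℂ] Ell2) = 0 at hD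
  change ψ (star (D : Ell2 →L[ℂ] Ell2) * (D : Ell2 →L[ℂ] Ell2)) = 0
  have h1 := hlim D
  rw [hD] at h1
  have h2 := (h1.star).mul h1
  rw [star_zero, zero_mul] at h2
  -- Diagonal entries are multiplicative on 𝔻, so (D* D)_ii = |D_ii|² tends to zero with D_ii.
  refine tendsto_nhds_unique (hlim _) (h2.congr fun i => ?_)
  rw [← inner_e i ((star (D : Ell2 →L[ℂ] Ell2) * (D : Ell2 →L[ℂ] Ell2)) (e i))]
  change _ = ⟪e i, star (D : Ell2 →L[ℂ] Ell2) ((D : Ell2 →L[ℂ] Ell2) (e i))⟫_ℂ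
  rw [ContinuousLinearMap.star_eq_adjoint, ContinuousLinearMap.adjoint_inner_right,
    IsDiagonal.apply_e D.2 i, inner_smul_left, inner_smul_right, inner_e_e, if_pos rfl, mul_one,
    lp.coeFn_smul, Pi.smul_apply, e_apply, if_pos rfl, smul_eq_mul, mul_one]
  rfl

/-- Limits of vector states concentrating along an ultrafilter extend the limit of diagonal
entries. -/
theorem extends_of_tendsto {U : Ultrafilter ℕ} {W : Ultrafilter Ell2}
    (hW : ∀ Z ∈ U, ∀ᶠ v in (W : Filter Ell2), ‖v‖ = 1 ∧ ∀ i ∉ Z, v i = 0)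
    {ψ ψ' : (Ell2 →L[ℂ] Ell2) →ₗ[ℂ] ℂ}
    (h : ∀ T : Ell2 →L[ℂ] Ell2, Filter.Tendsto (fun i => T (e i) i) U (nhds (ψ T)))
    (h' : ∀ T : Ell2 →L[ℂ] Ell2, Filter.Tendsto (fun v => ⟪v, T v⟫_ℂ) W (nhds (ψ' T))) :
    Extends ψ' (ψ.comp diagInclusion) := by
  intro D
  refine tendsto_nhds_unique (h' D) (Metric.tendsto_nhds.2 fun ε hε => ?_)
  change ∀ᶠ v in (W : Filter Ell2), dist ⟪v, (D : Ell2 →L[ℂ] Ell2) v⟫_ℂ (ψ D) < ε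
  -- On this index set D is within ε/2 of the scalar ψ(D), and v is eventually supported there.
  have hZ : {i | dist ((D : Ell2 →L[ℂ] Ell2) (e i) i) (ψ D) < ε / 2} ∈ U :=
    Metric.tendsto_nhds.1 (h D) (ε / 2) (by positivity)
  filter_upwards [hW _ hZ] with v hv
  have e1 : ⟪v, (D : Ell2 →L[ℂ] Ell2) v⟫_ℂ - ψ D = ⟪v, (D : Ell2 →L[ℂ] Ell2) v - ψ D • v⟫_ℂ := by
    rw [inner_sub_right, inner_smul_right, inner_self_eq_norm_sq_to_K, hv.1]
    simp
  have e2 : ‖(D : Ell2 →L[ℂ] Ell2) v - ψ D • v‖ ≤ ‖((ε / 2 : ℝ) : ℂ) • v‖ := by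
    refine lp.norm_mono two_ne_zero fun i => ?_
    rw [lp.coeFn_sub, Pi.sub_apply, lp.coeFn_smul, Pi.smul_apply, lp.coeFn_smul, Pi.smul_apply,
      IsDiagonal.apply D.2, smul_eq_mul, smul_eq_mul, ← sub_mul, norm_mul, norm_mul]
    by_cases hi : i ∈ {i | dist ((D : Ell2 →L[ℂ] Ell2) (e i) i) (ψ D) < ε / 2}
    · refine mul_le_mul_of_nonneg_right ?_ (norm_nonneg _)
      rw [← dist_eq_norm, Complex.norm_real, Real.norm_of_nonneg (by positivity)]
      exact (Set.mem_ofPred.1 hi).le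
    · rw [hv.2 i hi]
      simp
  rw [dist_eq_norm, e1]
  refine ((norm_inner_le_norm _ _).trans ?_).trans_lt (half_lt_self hε)
  rw [hv.1, one_mul]
  refine e2.trans_eq ?_
  rw [norm_smul, hv.1, mul_one, Complex.norm_real, Real.norm_of_nonneg (by positivity)]

end LimitStates

/-! Splitting of infinite Bessel families from unique extension -/

section InfiniteBessel

variable {G : Type*} [NormedAddCommGroup G] [InnerProductSpace ℂ G]

/-- The analysis operator of a Bessel family with bound one. -/
noncomputable def analysis (F : ℕ → G)
    (hF : ∀ (s : Finset ℕ) (x : G), ∑ k ∈ s, ‖⟪F k, x⟫_ℂ‖ ^ 2 ≤ ‖x‖ ^ 2) : G →L[ℂ] Ell2 :=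
  LinearMap.mkContinuous
    { toFun := fun x => ⟨fun k => ⟪F k, x⟫_ℂ,
        memℓp_gen' (C := ‖x‖ ^ 2) fun s => by simpa using hF s x⟩
      map_add' := fun x y => by ext k; exact inner_add_right _ _ _
      map_smul' := fun c x => by ext k; exact inner_smul_right _ _ _ } 1
    fun x => by
      rw [one_mul]
      refine lp.norm_le_of_forall_sum_le (by norm_num) (norm_nonneg _) fun s => ?_
      simpa using hF s x

/-- For the analysis operator Θ, the operator ΘΘ* has diagonal entries ‖F k‖² ≤ 1/4. If no finite
colouring worked, some limit of vector states with the same restriction to 𝔻 would be at least 1/2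
on it. -/
theorem KadisonSingerProperty.exists_bessel_coloring [CompleteSpace G] (h : KadisonSingerProperty)
    (F : ℕ → G) (hF : ∀ (s : Finset ℕ) (x : G), ∑ k ∈ s, ‖⟪F k, x⟫_ℂ‖ ^ 2 ≤ ‖x‖ ^ 2)
    (hsmall : ∀ k, ‖F k‖ ^ 2 ≤ 1 / 4) :
    ∃ (r : ℕ) (c : ℕ → Fin r), ∀ j, ∀ s : Finset ℕ, (∀ k ∈ s, c k = j) → ∀ x : G,
      ∑ k ∈ s, ‖⟪F k, x⟫_ℂ‖ ^ 2 ≤ 1 / 2 * ‖x‖ ^ 2 := by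
  by_contra hcon
  let Good : Set ℕ → Prop := fun Y => ∀ s : Finset ℕ, (↑s ⊆ Y) → ∀ x : G,
    ∑ k ∈ s, ‖⟪F k, x⟫_ℂ‖ ^ 2 ≤ 1 / 2 * ‖x‖ ^ 2
  -- Finitely many good sets cannot cover ℕ: otherwise, colouring each index by a good set
  -- containing it gives the excluded colouring.
  have hne : (Filter.generate {Y | Good Yᶜ}).NeBot := by
    rw [Filter.generate_neBot_iff]
    intro t ht hfin
    by_contra hempty
    rw [Set.not_nonempty_iff_eq_empty, Set.sInter_eq_empty_iff] at hempty
    choose c hct hc using hempty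
    obtain ⟨r, ⟨g⟩⟩ := @Finite.exists_equiv_fin t hfin
    refine hcon ⟨r, fun k => g ⟨c k, hct k⟩, fun j s hs x => ?_⟩
    refine ht (g.symm j).2 s (fun k hk => ?_) x
    rw [← hs k hk, Equiv.symm_apply_apply]
    exact hc k
  let U := Ultrafilter.of (Filter.generate {Y | Good Yᶜ})
  have hU : ∀ Y ∈ U, ¬ Good Y := by
    intro Y hY hgood
    have : Yᶜ ∈ U := Ultrafilter.of_le _
      (Filter.mem_generate_of_mem (by simpa using hgood))
    exact (Ultrafilter.compl_mem_iff_notMem.1 this) hY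
  let Θ := analysis F hF
  let Θ' := ContinuousLinearMap.adjoint Θ
  let A : Set ℕ → Set Ell2 := fun Z =>
    {v | ‖v‖ = 1 ∧ (∀ i ∉ Z, v i = 0) ∧ 1 / 2 ≤ ‖Θ' v‖ ^ 2}
  have hAmono : Monotone A := fun Y Z hYZ v hv =>
    ⟨hv.1, fun i hi => hv.2.1 i fun hY => hi (hYZ hY), hv.2.2⟩
  have hA : ((U : Filter ℕ).lift' A).NeBot := by
    rw [Filter.lift'_neBot_iff hAmono]
    intro Z hZ
    have hbad := hU Z hZ
    simp only [Good] at hbad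
    push Not at hbad
    obtain ⟨s, hs, x, hx⟩ := hbad
    set β := ∑ k ∈ s, ‖⟪F k, x⟫_ℂ‖ ^ 2 with hβ
    -- This is Θx cut to s, so ⟨Θ* v, x⟩ = ‖v‖² = β. Cauchy–Schwarz with ‖x‖² < 2β gives ‖Θ* v‖² ≥
    -- ‖v‖²/2.
    let v : Ell2 := ∑ k ∈ s, ⟪F k, x⟫_ℂ • e k
    have hvk : ∀ i, v i = if i ∈ s then ⟪F i, x⟫_ℂ else 0 := by
      intro i
      simp only [v]
      rw [lp.coeFn_sum, Finset.sum_apply]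
      simp [e_apply]
    have hinner : ∀ y : Ell2, (∀ k ∈ s, y k = ⟪F k, x⟫_ℂ) → ⟪v, y⟫_ℂ = (β : ℂ) := by
      intro y hy
      rw [sum_inner, hβ, Complex.ofReal_sum]
      refine Finset.sum_congr rfl fun k hk => ?_
      rw [inner_smul_left, inner_e, hy k hk, ← Complex.normSq_eq_conj_mul_self,
        Complex.normSq_eq_norm_sq]
    have hvv : ‖v‖ ^ 2 = β := by
      have := hinner v fun k hk => by rw [hvk, if_pos hk]
      rw [inner_self_eq_norm_sq_to_K] at this
      exact Complex.ofReal_injective (by rw [Complex.ofReal_pow]; exact this)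
    have hvx : ⟪Θ' v, x⟫_ℂ = (β : ℂ) := by
      rw [ContinuousLinearMap.adjoint_inner_left]
      exact hinner _ fun k _ => rfl
    have hβpos : 0 < β := lt_of_le_of_lt (by positivity) hx
    have h1 : β ≤ ‖Θ' v‖ * ‖x‖ := by
      have := norm_inner_le_norm (𝕜 := ℂ) (Θ' v) x
      rwa [hvx, Complex.norm_real, Real.norm_of_nonneg hβpos.le] at this
    have h2 : β ≤ 2 * ‖Θ' v‖ ^ 2 := by
      have h3 : β * β ≤ 2 * ‖Θ' v‖ ^ 2 * β := by
        calc β * β ≤ (‖Θ' v‖ * ‖x‖) * (‖Θ' v‖ * ‖x‖) := by gcongr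
          _ = ‖Θ' v‖ ^ 2 * ‖x‖ ^ 2 := by ring
          _ ≤ ‖Θ' v‖ ^ 2 * (2 * β) := by gcongr; linarith
          _ = _ := by ring
      exact le_of_mul_le_mul_right h3 hβpos
    have hv0 : 0 < ‖v‖ := by
      by_contra h0
      have : ‖v‖ = 0 := le_antisymm (not_lt.1 h0) (norm_nonneg _)
      rw [this] at hvv
      simp at hvv
      linarith
    refine ⟨((‖v‖⁻¹ : ℝ) : ℂ) • v, ?_, fun i hi => ?_, ?_⟩
    · rw [norm_smul, Complex.norm_real, norm_inv, norm_norm, inv_mul_cancel₀ hv0.ne']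
    · rw [lp.coeFn_smul, Pi.smul_apply, hvk, if_neg (fun h : i ∈ s => hi (hs h)), smul_zero]
    · rw [map_smul, norm_smul, Complex.norm_real, norm_inv, norm_norm, mul_pow, inv_pow, hvv,
        ← div_eq_inv_mul, le_div_iff₀ hβpos]
      linarith
  let W := Ultrafilter.of ((U : Filter ℕ).lift' A)
  have hWA : ∀ Z ∈ U, ∀ᶠ v in (W : Filter Ell2), v ∈ A Z := fun Z hZ =>
    Ultrafilter.of_le _ (Filter.mem_lift' hZ)
  obtain ⟨ψ, hψ, hψlim⟩ := exists_limit_state (U.map e)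
    (by simp [norm_e])
  obtain ⟨ψ', hψ', hψlim'⟩ := exists_limit_state W
    ((hWA _ Filter.univ_mem).mono fun v hv => hv.1)
  have hlim : ∀ T : Ell2 →L[ℂ] Ell2, Filter.Tendsto (fun i => T (e i) i) U (nhds (ψ T)) := by
    intro T
    have := hψlim T
    rw [Ultrafilter.coe_map, Filter.tendsto_map'_iff] at this
    exact this.congr fun i => inner_e_apply_e T i
  have hpure := isPureState_of_tendsto hψ hlim
  have hext := extends_of_tendsto (fun Z hZ => (hWA Z hZ).mono fun v hv => ⟨hv.1, hv.2.1⟩)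
    hlim hψlim'
  obtain ⟨ψ₀, -, -, huniq⟩ := h _ hpure
  have heq : ψ' = ψ := (huniq ψ' hψ' hext).trans (huniq ψ hψ fun T => rfl).symm
  have hform : ∀ v, ⟪v, (Θ ∘L Θ') v⟫_ℂ = ((‖Θ' v‖ ^ 2 : ℝ) : ℂ) := fun v => by
    rw [ContinuousLinearMap.comp_apply, ← ContinuousLinearMap.adjoint_inner_left,
      inner_self_eq_norm_sq_to_K]
    simp [Θ']
  have hΘe : ∀ i, Θ' (e i) = F i := fun i => by
    refine ext_inner_right ℂ fun x => ?_
    rw [ContinuousLinearMap.adjoint_inner_left, inner_e]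
    rfl
  have hlow : 1 / 2 ≤ (ψ' (Θ ∘L Θ')).re := by
    refine ge_of_tendsto ((Complex.continuous_re.tendsto _).comp (hψlim' (Θ ∘L Θ'))) ?_
    filter_upwards [hWA _ Filter.univ_mem] with v hv
    rw [Function.comp_apply, hform, Complex.ofReal_re]
    exact hv.2.2
  have hup : (ψ (Θ ∘L Θ')).re ≤ 1 / 4 := by
    refine le_of_tendsto' ((Complex.continuous_re.tendsto _).comp (hlim (Θ ∘L Θ'))) fun i => ?_
    rw [Function.comp_apply, ← inner_e_apply_e, hform, Complex.ofReal_re, hΘe]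
    exact hsmall i
  rw [heq] at hlow
  linarith

end InfiniteBessel

/-! The main implications -/

section Main

theorem ErasureConjecture.besselPartitionConjecture (h : ErasureConjecture) :
    BesselPartitionConjecture := by
  obtain ⟨ε, hε, K₀, H⟩ := h
  refine ⟨ε, hε, 2, K₀, fun K hK n f h1 h2 => ?_⟩
  obtain ⟨J, ⟨a, ha, hJ⟩, b, hb, hJc⟩ := H K hK n f h1 h2
  refine ⟨![J, Jᶜ], ⟨?_, fun i => ?_⟩, ?_⟩
  · simp [Fin.forall_fin_two, disjoint_compl_right, disjoint_compl_left]
  · by_cases hi : i ∈ J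
    · exact ⟨0, hi⟩
    · exact ⟨1, by simpa using hi⟩
  · have hsum : ∀ x, ∑ i ∈ J, ‖⟪f i, x⟫_ℂ‖ ^ 2 + ∑ i ∈ Jᶜ, ‖⟪f i, x⟫_ℂ‖ ^ 2 ≤ 1 * ‖x‖ ^ 2 :=
      fun x => by rw [Finset.sum_add_sum_compl]; exact h2.2 x
    rw [Fin.forall_fin_two]
    constructor
    · intro x
      have e1 := hsum x
      have e2 := hJc.2 x
      change ∑ i ∈ J, _ ≤ _
      nlinarith [sq_nonneg ‖x‖]
    · intro x
      have e1 := hsum x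
      have e2 := hJ.2 x
      change ∑ i ∈ Jᶜ, _ ≤ _
      nlinarith [sq_nonneg ‖x‖]

theorem IsParsevalFrame.norm_sq_eq {K n : ℕ} {f : Fin (K * n) → EuclideanSpace ℂ (Fin n)}
    (hf : IsParsevalFrame f) (he : IsEqualNorm f) (i : Fin (K * n)) :
    ‖f i‖ ^ 2 = (K : ℝ)⁻¹ := by
  have h := hf.sum_norm_sq
  rw [Finset.sum_congr rfl fun j _ => by rw [he j i]] at h
  simp only [Finset.sum_const, Finset.card_univ, Fintype.card_fin, nsmul_eq_mul, Nat.cast_mul] at h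
  have hpos : 0 < K * n := i.pos
  have hK : (K : ℝ) ≠ 0 := by exact_mod_cast (Nat.pos_of_mul_pos_right hpos).ne'
  have hn : (n : ℝ) ≠ 0 := by exact_mod_cast (Nat.pos_of_mul_pos_left hpos).ne'
  have h' : (n : ℝ) * (K * ‖f i‖ ^ 2) = n * 1 := by linarith
  exact eq_inv_of_mul_eq_one_right (mul_left_cancel₀ hn h')

/-- The summands of an ℓ₂ direct sum are orthogonal, so the joined frames keep Bessel bound one. A
colouring with r colours, restricted to the r-th summand, partitions the very frame chosen to resist
r pieces. -/
theorem KadisonSingerProperty.besselPartitionConjecture (h : KadisonSingerProperty) :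
    BesselPartitionConjecture := by
  by_contra hcon
  have hneg : ∀ r : ℕ, ∃ K, 4 ≤ K ∧ ∃ (n : ℕ) (f : Fin (K * n) → EuclideanSpace ℂ (Fin n)),
      IsEqualNorm f ∧ IsParsevalFrame f ∧ ∀ A : Fin r → Finset (Fin (K * n)), IsPartition A →
        ∃ j, ¬ IsBesselBound f (A j) (1 - 1 / 2) := by
    intro r
    by_contra hr
    push Not at hr
    -- With K ≥ 4 the vectors have squared norm 1/K ≤ 1/4, as the colouring theorem requires.
    exact hcon ⟨1 / 2, by norm_num, r, 4, fun K hK n f h1 h2 => hr K hK n f h1 h2⟩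
  choose K hK n f he hp hf using hneg
  let enc : (Σ r, Fin (K r * n r)) → ℕ := Encodable.encode
  have henc : Function.Injective enc := Encodable.encode_injective
  let G := lp (fun r => EuclideanSpace ℂ (Fin (n r))) 2
  let F₀ : (Σ r, Fin (K r * n r)) → G := fun s => lp.single 2 s.1 (f s.1 s.2)
  let F : ℕ → G := Function.extend enc F₀ 0
  have hFenc : ∀ s, F (enc s) = F₀ s := fun s => henc.extend_apply _ _ _
  have hFzero : ∀ k, k ∉ Set.range enc → F k = 0 := fun k hk =>
    Function.extend_apply' _ _ _ fun ⟨s, hs⟩ => hk ⟨s, hs⟩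
  have hinner : ∀ s (x : G), ⟪F₀ s, x⟫_ℂ = ⟪f s.1 s.2, x s.1⟫_ℂ := fun s x =>
    lp.inner_single_left _ _ _
  have hbessel : ∀ (t : Finset ℕ) (x : G), ∑ k ∈ t, ‖⟪F k, x⟫_ℂ‖ ^ 2 ≤ ‖x‖ ^ 2 := by
    intro t x
    rw [← Finset.sum_preimage enc t henc.injOn (fun k => ‖⟪F k, x⟫_ℂ‖ ^ 2)
      (fun k _ hk => by simp [hFzero k hk])]
    set u := t.preimage enc henc.injOn
    have hsub : u ⊆ (u.image Sigma.fst).sigma fun _ => Finset.univ := fun s hs =>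
      Finset.mem_sigma.2 ⟨Finset.mem_image_of_mem _ hs, Finset.mem_univ _⟩
    refine (Finset.sum_le_sum_of_subset_of_nonneg hsub fun _ _ _ => by positivity).trans ?_
    rw [Finset.sum_sigma]
    have h1 : ∀ r ∈ u.image Sigma.fst,
        ∑ i, ‖⟪F (enc ⟨r, i⟩), x⟫_ℂ‖ ^ 2 ≤ ‖x r‖ ^ 2 := fun r _ => by
      simp only [hFenc, hinner]
      exact ((hp r).2 (x r)).trans_eq (one_mul _)
    refine (Finset.sum_le_sum h1).trans ?_
    simpa using lp.sum_rpow_le_norm_rpow (p := 2) (by norm_num) x (u.image Sigma.fst)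
  have hsmall : ∀ k, ‖F k‖ ^ 2 ≤ 1 / 4 := by
    intro k
    by_cases hk : k ∈ Set.range enc
    · obtain ⟨s, rfl⟩ := hk
      rw [hFenc, lp.norm_single (by norm_num), (hp s.1).norm_sq_eq (he s.1), one_div]
      exact inv_anti₀ (by norm_num) (by exact_mod_cast hK s.1)
    · rw [hFzero k hk]
      norm_num
  obtain ⟨r, c, hc⟩ := h.exists_bessel_coloring F hbessel hsmall
  obtain ⟨j, hj⟩ := hf r (fun j => Finset.univ.filter fun i => c (enc ⟨r, i⟩) = j)
    ⟨fun j k hjk => Finset.disjoint_filter.2 fun i _ h1 h2 => hjk (h1.symm.trans h2),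
      fun i => ⟨_, Finset.mem_filter.2 ⟨Finset.mem_univ _, rfl⟩⟩⟩
  refine hj fun x => ?_
  let g : Fin (K r * n r) ↪ ℕ := ⟨fun i => enc ⟨r, i⟩, fun i i' hi => by
    simpa using henc hi⟩
  have := hc j ((Finset.univ.filter fun i => c (enc ⟨r, i⟩) = j).map g) (by
    intro k hk
    obtain ⟨i, hi, rfl⟩ := Finset.mem_map.1 hk
    exact (Finset.mem_filter.1 hi).2) (lp.single 2 r x)
  rw [Finset.sum_map, lp.norm_single (by norm_num)] at this
  have e1 : ∀ i, ⟪F (g i), (lp.single 2 r x : G)⟫_ℂ = ⟪f r i, x⟫_ℂ := fun i => by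
    change ⟪F (enc ⟨r, i⟩), (lp.single 2 r x : G)⟫_ℂ = _
    rw [hFenc, hinner]
    simp
  simp only [e1] at this
  linarith

end Main

end KadisonSinger

theorem mainTheorem5 :
    (KadisonSinger.ErasureConjecture → KadisonSinger.BesselPartitionConjecture) ∧
    (KadisonSinger.BesselPartitionConjecture ↔ KadisonSinger.KadisonSingerProperty) :=
  ⟨fun h => h.besselPartitionConjecture,
    fun h => h.projectionPaving_two.kadisonSingerProperty,
    fun h => h.besselPartitionConjecture⟩
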